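/- **Setting.** Atoms are natural numbers. A clause $H\leftarrow B$ is a pair of finite sets of atoms (head, body); it is *disjunctive* if $|H|>1$ and *Horn* otherwise. A theory $\Pi$ is a finite set of clauses; it is *positive* if no head is empty, and *non-disjunctive* if all its clauses are Horn. $at(\Pi)$ is the set of atoms occurring in $\Pi$ and $\Pi^{nd}$ the set of Horn clauses of $\Pi$. A clause is true in a set $I$ of atoms if $H\cap I\neq\emptyset$ or $B\not\subseteq I$; a *model* of $\Pi$ is a set $I\subseteq at(\Pi)$ in which all clauses of $\Pi$ are true, and it is *minimal* if no proper subset of it is a model. For a set $X$ of atoms, $\Pi_{X\leftarrow}$ consists of the clauses $H\cap X\leftarrow B$, and $\Pi_X$ of the clauses $H\cap X\leftarrow B\cap X$, with $(H\leftarrow B)\in\Pi$ and $H\cap X\neq\emptyset$. The *steady set* $S=S(\Pi,M)$ is the unique minimal model of $(\Pi_{M\leftarrow})^{nd}$. The *simplified theory* is $\Pi[M]=\{(H\leftarrow B)\in\Pi: H\cap S=\emptyset,\ B\subseteq M\}_{M\setminus S}$. **The operator $\xi_{\rm HEF}(\Pi,M)$.** 1. Set $E'=\emptyset$ and repeat: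 replace $M$ by $M\setminus E'$ and let $S=S(\Pi,M)$; if $at(\Pi[M])\subsetneq M\setminus S$, let $\Delta=(M\setminus S)\setminus at(\Pi[M])$; else if $at(\Pi[M]^{nd})\subsetneq M\setminus S$, select an atom $a\in(M\setminus S)\setminus at(\Pi[M]^{nd})$ and let $\Delta=\{a\}$; else let $\Delta=\emptyset$; replace $E'$ by $E'\cup\Delta$; until $\Delta=\emptyset$. 2. With the final $M$ and $S$, let $E''=M\setminus S$ if $\Pi[M]$ is non-disjunctive, and otherwise let $E''$ be the result of the following search on $\Theta=\Pi[M]$: start with $X=at(\Theta)$; as long as the elementary subgraph of $X$ for $\Theta^{nd}$ is not strongly connected, select a strongly connected component in its last level (that is, one that no arc leaves; isolated components are included) and remove it from $X$; return $X$. 3. Return $E'\cup E''$. The elementary subgraph of $X$ for a Horn theory $\Theta$ has node set $X$. Its arcs are found by starting with no arcs and all clauses of $\Theta_X$, and repeating, until no clause qualifies: take all remaining clauses whose body lies in one strongly connected component of the current graph, add the arcs $(b,h)$ from their body atoms $b$ to their head atom $h$, and discard these clauses. (The assertion is also made for the variant in which the test is that the subgraph induced by the body is strongly connected.) A *selection rule*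 picks an element of every non-empty finite set of atoms; it resolves the selections above, a component being selected by selecting an atom from the union of the components in the last level. **Polynomial time** means: computed by a program of a simple structured language over binary trees, where each executed construct costs the size of the tree it is applied to, in time bounded by a polynomial in the size of the input. Atoms are given in binary, and finite sets by arbitrary lists of their elements (order and repetitions being irrelevant). A *fallible eliminating operator* is a polynomial-time computable function $\xi$ that maps every pair of a positive theory $\Pi$ and a model $M$ of $\Pi$, with steady set $S$, to a subset of $M\setminus S$, such that $\xi(\Pi,M)=\emptyset$ only if $M$ is a minimal model of $\Pi$. **Proposition.** There are polynomial-time computable selection rules, and for each of them $\xi_{\rm HEF}$ is a fallible eliminating operator. Moreover, for every selection rule (of whatever complexity), every positive theory $\Pi$ and every model $M$ of $\Pi$ with steady set $S$: $\xi_{\rm HEF}(\Pi,M)\subseteq M\setminus S$; if $S$ is not a model of $\Pi$, then $\xi_{\rm HEF}(\Pi,M)\neq\emptyset$; and if $\xi_{\rm HEF}(\Pi,M)=\emptyset$, then $M$ is a minimal model of $\Pi$. -/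

import Mathlib

namespace MinModel

/-! ### Clauses, theories, models -/

/-- A clause `H ← B`; atoms (propositional letters) are natural numbers. -/
@[ext] structure Clause where
  head : Finset ℕ
  body : Finset ℕ
  deriving DecidableEq

/-- A theory is a finite set of clauses. -/
abbrev Theory := Finset Clause

def Clause.atoms (c : Clause) : Finset ℕ := c.head ∪ c.body

/-- A clause is disjunctive if its head has more than one atom; otherwise it is Horn. -/
def Clause.Disjunctive (c : Clause) : Prop := 1 < c.head.card

def Clause.TrueIn (c : Clause) (I : Finset ℕ) : Prop :=
  (∃ a ∈ c.head, a ∈ I) ∨ ∃ b ∈ c.body, b ∉ I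

/-- `c_{X←}`: the head is projected on `X`. -/
def Clause.projHead (X : Finset ℕ) (c : Clause) : Clause := ⟨c.head ∩ X, c.body⟩

/-- `c_X`: head and body are projected on `X`. -/
def Clause.proj (X : Finset ℕ) (c : Clause) : Clause := ⟨c.head ∩ X, c.body ∩ X⟩

namespace Theory

/-- The set of atoms occurring in a theory. -/
def atoms (T : Theory) : Finset ℕ := T.biUnion Clause.atoms

/-- No clause has an empty head. -/
def Positive (T : Theory) : Prop := ∀ c ∈ T, c.head.Nonempty

def NonDisjunctive (T : Theory) : Prop := ∀ c ∈ T, ¬ c.Disjunctive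

/-- All clauses of `T` are true in `I`. -/
def Sat (T : Theory) (I : Finset ℕ) : Prop := ∀ c ∈ T, c.TrueIn I

/-- A model is an interpretation (a set of atoms of `T`) in which all clauses are true. -/
def IsModel (T : Theory) (I : Finset ℕ) : Prop := I ⊆ T.atoms ∧ T.Sat I

def IsMinimalModel (T : Theory) (I : Finset ℕ) : Prop :=
  T.IsModel I ∧ ∀ J, J ⊂ I → ¬ T.IsModel J

open scoped Classical in
/-- `T^nd`: the Horn clauses of `T`. -/
noncomputable def nd (T : Theory) : Theory := T.filter fun c => ¬ c.Disjunctive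

/-- `T_{X←}`: the non-empty-head clauses among the `c_{X←}`. -/
def projHead (T : Theory) (X : Finset ℕ) : Theory :=
  (T.image (Clause.projHead X)).filter fun c => c.head.Nonempty

/-- `T_X`: the non-empty-head clauses among the `c_X`. -/
def proj (T : Theory) (X : Finset ℕ) : Theory :=
  (T.image (Clause.proj X)).filter fun c => c.head.Nonempty

open scoped Classical in
/-- The steady set of `M` for `T`: the minimal model of `(T_{M←})^nd`. It is written here as the
intersection of the sets `I ⊆ M` that satisfy this Horn theory; see `steadySet_isMinimalModel`
and `steadySet_unique`. -/
noncomputable def steadySet (T : Theory) (M : Finset ℕ) : Finset ℕ :=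
  M.filter fun a => ∀ I, I ⊆ M → (T.projHead M).nd.Sat I → a ∈ I

open scoped Classical in
theorem steadySet_sat (T : Theory) (M : Finset ℕ) :
    (T.projHead M).nd.Sat (T.steadySet M) := by
  intro c hc
  by_cases hb : ∃ b ∈ c.body, b ∉ T.steadySet M
  · exact Or.inr hb
  left
  push Not at hb
  obtain ⟨hc', hcard⟩ := Finset.mem_filter.1 hc
  obtain ⟨hi, hne⟩ := Finset.mem_filter.1 hc'
  obtain ⟨c₀, -, rfl⟩ := Finset.mem_image.1 hi
  obtain ⟨a, ha⟩ := hne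
  refine ⟨a, ha, ?_⟩
  refine Finset.mem_filter.2 ⟨(Finset.mem_inter.1 ha).2, fun I hI hs => ?_⟩
  rcases hs _ hc with ⟨a', ha', haI⟩ | ⟨b, hbb, hbI⟩
  · have : a = a' := Finset.card_le_one.1 (not_lt.1 hcard) a ha a' ha'
    rwa [this]
  · exact absurd ((Finset.mem_filter.1 (hb b hbb)).2 I hI hs) hbI

open scoped Classical in
theorem steadySet_subset_of_sat {T : Theory} {M I : Finset ℕ}
    (h : (T.projHead M).nd.Sat I) : T.steadySet M ⊆ I := by
  have hM : (T.projHead M).nd.Sat (I ∩ M) := by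
    intro c hc
    have hc' := hc
    simp only [nd, projHead, Finset.mem_filter, Finset.mem_image] at hc'
    obtain ⟨⟨⟨c₀, -, rfl⟩, -⟩, -⟩ := hc'
    rcases h _ hc with ⟨a, ha, haI⟩ | ⟨b, hb, hbI⟩
    · exact Or.inl ⟨a, ha, Finset.mem_inter.2 ⟨haI, (Finset.mem_inter.1 ha).2⟩⟩
    · exact Or.inr ⟨b, hb, fun hh => hbI (Finset.mem_inter.1 hh).1⟩
  intro a ha
  exact (Finset.mem_inter.1
    ((Finset.mem_filter.1 ha).2 _ Finset.inter_subset_right hM)).1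

theorem steadySet_isMinimalModel (T : Theory) (M : Finset ℕ) :
    (T.projHead M).nd.IsMinimalModel (T.steadySet M) := by
  refine ⟨⟨?_, steadySet_sat T M⟩, fun J hJ hJm =>
    hJ.2 (steadySet_subset_of_sat hJm.2)⟩
  apply steadySet_subset_of_sat
  intro c hc
  have hc' := hc
  simp only [nd, projHead, Finset.mem_filter] at hc'
  obtain ⟨a, ha⟩ := hc'.1.2
  exact Or.inl ⟨a, ha, Finset.mem_biUnion.2 ⟨c, hc, Finset.mem_union_left _ ha⟩⟩

theorem steadySet_unique {T : Theory} {M I : Finset ℕ}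
    (h : (T.projHead M).nd.IsMinimalModel I) : I = T.steadySet M := by
  by_contra hne
  exact h.2 _ ((steadySet_subset_of_sat h.1.2).ssubset_of_ne (Ne.symm hne))
    (steadySet_isMinimalModel T M).1

open scoped Classical in
/-- The clauses `H ← B` of `T` with `H ∩ S = ∅` and `B ⊆ M`, `S` being the steady set. -/
noncomputable def simpl (T : Theory) (M : Finset ℕ) : Theory :=
  T.filter fun c => Disjoint c.head (T.steadySet M) ∧ c.body ⊆ M

/-- The simplified theory of `T` with respect to `M`. -/
noncomputable def ssimpl (T : Theory) (M : Finset ℕ) : Theory :=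
  (T.simpl M).proj (M \ T.steadySet M)

end Theory

/-! ### Directed graphs `⟨X, E⟩` on finite sets of atoms -/

/-- Reachability along arcs of `E`. -/
def Reach (E : Finset (ℕ × ℕ)) : ℕ → ℕ → Prop :=
  Relation.ReflTransGen fun u v => (u, v) ∈ E

def StronglyConnected (X : Finset ℕ) (E : Finset (ℕ × ℕ)) : Prop :=
  ∀ u ∈ X, ∀ v ∈ X, Reach E u v

/-- The arcs of the subgraph induced by `B`. -/
def inducedArcs (B : Finset ℕ) (E : Finset (ℕ × ℕ)) : Finset (ℕ × ℕ) :=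
  E.filter fun e => e.1 ∈ B ∧ e.2 ∈ B

open scoped Classical in
/-- The strongly connected component of `u` in `⟨X, E⟩`. -/
noncomputable def component (X : Finset ℕ) (E : Finset (ℕ × ℕ)) (u : ℕ) : Finset ℕ :=
  X.filter fun v => Reach E u v ∧ Reach E v u

open scoped Classical in
/-- The atoms of the components in the last level of `⟨X, E⟩`: the components that no arc leaves
(isolated components are among them). -/
noncomputable def lastLevel (X : Finset ℕ) (E : Finset (ℕ × ℕ)) : Finset ℕ :=
  X.filter fun u => ∀ v ∈ component X E u, ∀ w ∈ X, (v, w) ∈ E → w ∈ component X E u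

open scoped Classical in
theorem mem_component_self {X : Finset ℕ} (E : Finset (ℕ × ℕ)) {u : ℕ} (hu : u ∈ X) :
    u ∈ component X E u :=
  Finset.mem_filter.2 ⟨hu, Relation.ReflTransGen.refl, Relation.ReflTransGen.refl⟩

open scoped Classical in
theorem lastLevel_nonempty {X : Finset ℕ} (E : Finset (ℕ × ℕ)) (hX : X.Nonempty) :
    (lastLevel X E).Nonempty := by
  obtain ⟨u, hu, hmin⟩ := X.exists_min_image (fun u => (X.filter fun v => Reach E u v).card) hX
  refine ⟨u, Finset.mem_filter.2 ⟨hu, fun v hv w hw hvw => ?_⟩⟩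
  obtain ⟨-, huv, -⟩ := Finset.mem_filter.1 hv
  have huw : Reach E u w := huv.tail hvw
  refine Finset.mem_filter.2 ⟨hw, huw, ?_⟩
  have hsub : (X.filter fun z => Reach E w z) ⊆ X.filter fun z => Reach E u z := fun z hz =>
    Finset.mem_filter.2 ⟨(Finset.mem_filter.1 hz).1, huw.trans (Finset.mem_filter.1 hz).2⟩
  have heq := Finset.eq_of_subset_of_card_le hsub (hmin w hw)
  have : u ∈ X.filter fun z => Reach E u z :=
    Finset.mem_filter.2 ⟨hu, Relation.ReflTransGen.refl⟩
  rw [← heq] at this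
  exact (Finset.mem_filter.1 this).2

/-! ### Elementary subgraphs and the search for a super-elementary set -/

/-- Two forms of the test that a clause body has to pass in the construction of the elementary
subgraph. -/
inductive BodyTest
  /-- The body lies in one strongly connected component of the current graph. -/
  | sameComponent
  /-- The subgraph of the current graph induced by the body is strongly connected. -/
  | inducedSubgraph

def BodyTest.Holds (E : Finset (ℕ × ℕ)) (c : Clause) : BodyTest → Prop
  | .sameComponent => StronglyConnected c.body E
  | .inducedSubgraph => StronglyConnected c.body (inducedArcs c.body E)

/-- The arcs `(b, h)` with `b` in the body and `h` in the head of a clause of `T`. -/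
def arcs (T : Theory) : Finset (ℕ × ℕ) := T.biUnion fun c => c.body ×ˢ c.head

open scoped Classical in
/-- The loop that builds the elementary subgraph: `T` holds the clauses not used so far and `E`
the arcs found so far. -/
noncomputable def elemLoop (test : BodyTest) (T : Theory) (E : Finset (ℕ × ℕ)) :
    Finset (ℕ × ℕ) :=
  let C := T.filter fun c => test.Holds E c
  if C = ∅ then E else elemLoop test (T \ C) (E ∪ arcs C)
termination_by T.card
decreasing_by
  rename_i h
  exact Finset.card_lt_card (Finset.sdiff_ssubset (Finset.filter_subset _ _)
    (Finset.nonempty_iff_ne_empty.2 h))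

/-- The arcs of the elementary subgraph of `X` for the Horn theory `T`. Its nodes are the atoms
in `X`, so only the parts of the clauses inside `X` matter. -/
noncomputable def elemArcs (test : BodyTest) (T : Theory) (X : Finset ℕ) : Finset (ℕ × ℕ) :=
  elemLoop test (T.proj X) ∅

/-- A rule for resolving the arbitrary selections of the algorithm: it picks an element of every
non-empty finite set of atoms. -/
structure SelectionRule where
  pick : Finset ℕ → ℕ
  pick_mem : ∀ s : Finset ℕ, s.Nonempty → pick s ∈ s

open scoped Classical in
/-- The loop of the search: `X` is returned if its elementary subgraph is strongly connected;
otherwise a component in the last level is selected (by selecting one of its atoms) and removed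
from `X`. -/
noncomputable def findLoop (test : BodyTest) (sel : SelectionRule) (T : Theory) (X : Finset ℕ) :
    Finset ℕ :=
  let E := elemArcs test T.nd X
  if StronglyConnected X E then X
  else findLoop test sel T (X \ component X E (sel.pick (lastLevel X E)))
termination_by X.card
decreasing_by
  rename_i h
  have hX : X.Nonempty := by
    by_contra hne
    rw [Finset.not_nonempty_iff_eq_empty] at hne
    exact h (by simp [StronglyConnected, hne])
  have hp := sel.pick_mem _ (lastLevel_nonempty (elemArcs test T.nd X) hX)
  exact Finset.card_lt_card (Finset.sdiff_ssubset (Finset.filter_subset _ _)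
    ⟨_, mem_component_self _ (Finset.mem_filter.1 hp).1⟩)

/-- The function `find_super-elementary_set`. -/
noncomputable def findSuperElementarySet (test : BodyTest) (sel : SelectionRule) (T : Theory) :
    Finset ℕ :=
  findLoop test sel T T.atoms

/-! ### The operator `ξ_HEF` -/

open scoped Classical in
/-- The set `ΔE` computed in one iteration of the main loop of `ξ_HEF`. -/
noncomputable def deltaE (sel : SelectionRule) (T : Theory) (M : Finset ℕ) : Finset ℕ :=
  let S := T.steadySet M
  if (T.ssimpl M).atoms ⊂ M \ S then (M \ S) \ (T.ssimpl M).atoms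
  else if (T.ssimpl M).nd.atoms ⊂ M \ S then {sel.pick ((M \ S) \ (T.ssimpl M).nd.atoms)}
  else ∅

theorem deltaE_subset (sel : SelectionRule) (T : Theory) (M : Finset ℕ) :
    deltaE sel T M ⊆ M := by
  unfold deltaE
  simp only
  split_ifs with h₁ h₂
  · exact Finset.sdiff_subset.trans Finset.sdiff_subset
  · have hne : ((M \ T.steadySet M) \ (T.ssimpl M).nd.atoms).Nonempty :=
      Finset.sdiff_nonempty.2 h₂.2
    have := sel.pick_mem _ hne
    exact Finset.singleton_subset_iff.2
      (Finset.sdiff_subset (Finset.sdiff_subset this))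
  · exact Finset.empty_subset _

/-- The main loop of `ξ_HEF`, with the current values of `M` and `E'`. It returns the final
values. -/
noncomputable def xiLoop (sel : SelectionRule) (T : Theory) (M E' : Finset ℕ) :
    Finset ℕ × Finset ℕ :=
  let M₁ := M \ E'
  let D := deltaE sel T M₁
  if D = ∅ then (M₁, E' ∪ D) else xiLoop sel T M₁ (E' ∪ D)
termination_by (M \ E').card
decreasing_by
  rename_i h
  obtain ⟨a, ha⟩ := Finset.nonempty_iff_ne_empty.2 h
  have haM := deltaE_subset sel T _ ha
  refine Finset.card_lt_card (Finset.ssubset_iff_subset_ne.2 ⟨Finset.sdiff_subset, fun he => ?_⟩)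
  have haM' : a ∈ (M \ E') \ (E' ∪ deltaE sel T (M \ E')) := by
    rw [he]; exact haM
  exact (Finset.mem_sdiff.1 haM').2 (Finset.mem_union_right _ ha)

open scoped Classical in
/-- The operator `ξ_HEF`. -/
noncomputable def xiHEF (test : BodyTest) (sel : SelectionRule) (T : Theory) (M : Finset ℕ) :
    Finset ℕ :=
  let R := xiLoop sel T M ∅
  let M' := R.1
  let E' := R.2
  let E'' :=
    if (T.ssimpl M').NonDisjunctive then M' \ T.steadySet M'
    else findSuperElementarySet test sel (T.ssimpl M')
  E' ∪ E''

/-! ### Polynomial time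

The machine model is a structured programming language over binary trees (as in Lisp or in Jones's
WHILE language), with one data register. Every construct that is executed costs the size of the
register it is executed on, so that time `t` is polynomially related to time on Turing machines. -/

inductive Data
  | nil
  | cons (l r : Data)
  deriving DecidableEq

namespace Data

def size : Data → ℕ
  | nil => 1
  | cons l r => l.size + r.size + 1

def left : Data → Data
  | nil => nil
  | cons l _ => l

def right : Data → Data
  | nil => nil
  | cons _ r => r

/-- `nil` stands for false, every other tree for true. -/
def ofBool : Bool → Data
  | false => nil
  | true => cons nil nil

def ofList : List Data → Data
  | [] => nil
  | d :: l => cons d (ofList l)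

/-- The binary digits of a natural number, least significant first. -/
def ofNat (n : ℕ) : Data := ofList (n.bits.map ofBool)

end Data

inductive Prog
  /-- the constant tree `nil` -/
  | nil
  /-- leave the register unchanged -/
  | id
  /-- left subtree -/
  | left
  /-- right subtree -/
  | right
  /-- are the two subtrees equal? -/
  | eq
  /-- run both programs on the register and combine the results into one tree -/
  | pair (p q : Prog)
  /-- run `p`, then `q` -/
  | seq (p q : Prog)
  /-- run `p` if the result of the test `b` is not `nil`, and `q` otherwise -/
  | ite (b p q : Prog)
  /-- run `p` as long as the result of the test `b` is not `nil` -/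
  | while (b p : Prog)

/-- `Runs p x y t`: program `p`, started on `x`, halts with result `y` after time `t`. -/
inductive Runs : Prog → Data → Data → ℕ → Prop
  | nil (x) : Runs .nil x .nil x.size
  | id (x) : Runs .id x x x.size
  | left (x) : Runs .left x x.left x.size
  | right (x) : Runs .right x x.right x.size
  | eq (x) : Runs .eq x (.ofBool (decide (x.left = x.right))) x.size
  | pair {p q x y z s t} : Runs p x y s → Runs q x z t →
      Runs (.pair p q) x (.cons y z) (x.size + s + t)
  | seq {p q x y z s t} : Runs p x y s → Runs q y z t →
      Runs (.seq p q) x z (x.size + s + t)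
  | ite_true {b p q x v y s t} : Runs b x v s → v ≠ .nil → Runs p x y t →
      Runs (.ite b p q) x y (x.size + s + t)
  | ite_false {b p q x y s t} : Runs b x .nil s → Runs q x y t →
      Runs (.ite b p q) x y (x.size + s + t)
  | while_true {b p x v y z s t u} : Runs b x v s → v ≠ .nil → Runs p x y t →
      Runs (.while b p) y z u → Runs (.while b p) x z (x.size + s + t + u)
  | while_false {b p x s} : Runs b x .nil s → Runs (.while b p) x x (x.size + s)

/-- A representation of the objects of a type by trees: `r a d` says that `d` represents `a`. -/
abbrev Rep (α : Type) := α → Data → Prop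

/-- A finite set is represented by any list of representations of its elements that omits none
(in any order, repetitions allowed). -/
def Rep.finset {α : Type} (r : Rep α) : Rep (Finset α) := fun s d =>
  ∃ l : List Data, d = .ofList l ∧ (∀ e ∈ l, ∃ a ∈ s, r a e) ∧ ∀ a ∈ s, ∃ e ∈ l, r a e

def Rep.prod {α β : Type} (r : Rep α) (r' : Rep β) : Rep (α × β) := fun x d =>
  ∃ e f, d = .cons e f ∧ r x.1 e ∧ r' x.2 f

def repAtom : Rep ℕ := fun a d => d = .ofNat a

def repAtoms : Rep (Finset ℕ) := repAtom.finset

def repClause : Rep Clause := fun c d => (repAtoms.prod repAtoms) (c.head, c.body) d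

def repTheory : Rep Theory := repClause.finset

/-- The function `f` is computable on the domain `D` in time polynomial in the size of the
input. -/
def PolyTimeOn {α β : Type} (r : Rep α) (r' : Rep β) (D : Set α) (f : α → β) : Prop :=
  ∃ (p : Prog) (q : Polynomial ℕ), ∀ x ∈ D, ∀ d, r x d →
    ∃ e t, Runs p d e t ∧ r' (f x) e ∧ t ≤ q.eval d.size

def SelectionRule.PolyTime (sel : SelectionRule) : Prop :=
  PolyTimeOn repAtoms repAtom {s | s.Nonempty} sel.pick

/-- A fallible eliminating operator: a polynomial-time computable function that maps a positive
theory `T` and a model `M` of `T` to a subset of `M \ S`, where `S` is the steady set, and that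
returns the empty set only if `M` is a minimal model of `T`. -/
def IsFallibleEliminatingOperator (ξ : Theory → Finset ℕ → Finset ℕ) : Prop :=
  PolyTimeOn (repTheory.prod repAtoms) repAtoms
      {x | Theory.Positive x.1 ∧ Theory.IsModel x.1 x.2} (fun x => ξ x.1 x.2) ∧
    ∀ (T : Theory) (M : Finset ℕ), T.Positive → T.IsModel M →
      ξ T M ⊆ M \ T.steadySet M ∧ (ξ T M = ∅ → T.IsMinimalModel M)

end MinModel

namespace MinModel

/-! ### Running times and sizes -/

/-! The combinatorial claims need nothing about elementary sets. Write `S(M)` for the steady set.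
Each round of the main loop removes atoms outside the current steady set, and this never shrinks the
steady set (`steadySet_subset_steadySet`). Hence the final `M'` satisfies `S(M) ⊆ S(M') ⊆ M' ⊆ M`,
and `E'` is exactly `M \ M'` (`xiLoop_empty`). Since `E'' ⊆ M' \ S(M')`, the result lies in `M \
S(M)`.

If the result is empty, then `M' = M`. The simplified theory cannot be disjunctive: it would have an
atom, and the search, started on a non-empty set, removes one component at a time from graphs that
are not strongly connected, so it never reaches the empty set (`findLoop_nonempty`). Thus `M \ S(M)
= ∅`. A model equal to its steady set is minimal, because every model inside `M` satisfies the Horn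
theory that defines `S(M)`. If `S(M)` is not a model it differs from the model `M`, so the result is
non-empty.

Polynomial time is obtained from closure properties of the class `PTime` of functions between
represented types. Composition works because a result is at most linear in the running time. Two
devices handle loops: `PTime.collect` for unions over a finite set, and `PTime.iterate` for
iterating an operation on subsets of a computable set. Every recursion of the algorithm becomes such
an iteration: steady set, reachability and elementary subgraph are least fixed points reached from
below (`iterate_eq_of_inflationary`), while the search and the main loop only remove atoms
(`iterate_eq_of_deflationary`, `xiLoop_eq_iterate`). A polynomial-time selection rule picks the
least atom in the lexicographic order of digit sequences. -/

theorem eval_mono (q : Polynomial ℕ) {m n : ℕ} (h : m ≤ n) : q.eval m ≤ q.eval n := by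
  rw [Polynomial.eval_eq_sum_range, Polynomial.eval_eq_sum_range]
  gcongr

namespace Data

theorem size_pos (d : Data) : 0 < d.size := by cases d <;> simp [size]

theorem size_left_le (d : Data) : d.left.size ≤ d.size := by
  cases d <;> simp [size, left]; omega

theorem size_right_le (d : Data) : d.right.size ≤ d.size := by
  cases d <;> simp [size, right]; omega

theorem size_ofBool_le (b : Bool) : (ofBool b).size ≤ 3 := by
  cases b <;> simp [ofBool, size]

def toList : Data → List Data
  | nil => []
  | cons l r => l :: r.toList

@[simp] theorem ofList_toList (d : Data) : ofList d.toList = d := by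
  induction d with
  | nil => rfl
  | cons l r _ ih => simp [toList, ofList, ih]

@[simp] theorem toList_ofList (l : List Data) : (ofList l).toList = l := by
  induction l with
  | nil => rfl
  | cons a l ih => simp [toList, ofList, ih]

theorem ofList_injective : Function.Injective ofList := fun l m h => by
  rw [← toList_ofList l, h, toList_ofList]

theorem ofBool_injective : Function.Injective ofBool := by
  intro a b; cases a <;> cases b <;> simp [ofBool]

theorem ofNat_injective : Function.Injective ofNat := by
  intro m n h
  have := List.map_injective_iff.2 ofBool_injective (ofList_injective h)
  exact Nat.digits.injective 2 (by rw [Nat.digits_two_eq_bits, this, Nat.digits_two_eq_bits])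

theorem size_ofList (l : List Data) : (ofList l).size = (l.map fun d => d.size + 1).sum + 1 := by
  induction l with
  | nil => rfl
  | cons a l ih => simp [ofList, size, ih]; omega

theorem length_lt_size_ofList (l : List Data) : l.length < (ofList l).size := by
  induction l with
  | nil => simp [ofList, size]
  | cons a l ih => simp [ofList, size]; omega

theorem size_lt_of_mem {d : Data} {l : List Data} (h : d ∈ l) : d.size < (ofList l).size := by
  induction l with
  | nil => simp at h
  | cons a l ih =>
    rcases List.mem_cons.1 h with rfl | h
    · simp only [ofList, size]; omega
    · have := ih h; simp [ofList, size]; omega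

theorem size_ofList_append (l m : List Data) :
    (ofList (l ++ m)).size + 1 = (ofList l).size + (ofList m).size := by
  simp [size_ofList]; omega

theorem size_ofList_reverse (l : List Data) : (ofList l.reverse).size = (ofList l).size := by
  simp [size_ofList, List.sum_reverse]

theorem size_ofList_le_of_sublist {l m : List Data} (h : l.Sublist m) :
    (ofList l).size ≤ (ofList m).size := by
  induction h with
  | slnil => exact le_rfl
  | cons a _ ih => simp [ofList, size]; omega
  | cons_cons a _ ih => simp [ofList, size]; omega

end Data

/-- The result of a program is at most three times as large as the time spent on it. -/
theorem Runs.size_le {p x y t} (h : Runs p x y t) : y.size ≤ 3 * t := by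
  induction h with
  | nil x => have := x.size_pos; simp [Data.size]; omega
  | id x => omega
  | left x => have := x.size_left_le; omega
  | right x => have := x.size_right_le; omega
  -- The factor 3 is needed here: on input `nil`, of size 1, the answer is the tree for true, of
  -- size 3.
  | eq x =>
    have := x.size_pos
    have := Data.size_ofBool_le (decide (x.left = x.right)); omega
  | pair _ _ _ _ =>
    rename_i x _ _ _ _ _ _ _ _
    have := x.size_pos
    simp only [Data.size]; omega
  | seq => omega
  | ite_true => omega
  | ite_false => omega
  | while_true => omega
  | while_false => omega

/-- A loop that is controlled by a counted invariant and whose rounds take time at most `C`. -/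
theorem runs_while {b p : Prog} {C : ℕ} (Inv : ℕ → Data → Prop)
    (h₀ : ∀ d, Inv 0 d → ∃ t, Runs b d .nil t ∧ d.size + t ≤ C)
    (h₁ : ∀ n d, Inv (n + 1) d → ∃ v s d' t, Runs b d v s ∧ v ≠ .nil ∧ Runs p d d' t ∧
      Inv n d' ∧ d.size + s + t ≤ C) :
    ∀ n d, Inv n d → ∃ e t, Runs (.while b p) d e t ∧ Inv 0 e ∧ t ≤ (n + 1) * C := by
  intro n
  induction n with
  | zero =>
    intro d hd
    obtain ⟨t, ht, hC⟩ := h₀ d hd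
    exact ⟨d, _, .while_false ht, hd, by omega⟩
  | succ n ih =>
    intro d hd
    obtain ⟨v, s, d', t, hb, hv, hp, hd', hC⟩ := h₁ n d hd
    obtain ⟨e, u, he, hInv, hu⟩ := ih d' hd'
    exact ⟨e, _, .while_true hb hv hp he, hInv, by
      have : (n + 1 + 1) * C = (n + 1) * C + C := by ring
      omega⟩

/-! ### Represented types and polynomial-time functions -/

/-- A type whose elements are represented by trees, a tree representing at most one element. -/
class HasRep (α : Type) where
  rep : Rep α
  exists_rep : ∀ a, ∃ d, rep a d
  rep_inj : ∀ {a b d}, rep a d → rep b d → a = b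

open HasRep

instance : HasRep Data := ⟨fun a d => a = d, fun a => ⟨a, rfl⟩, fun h h' => h.trans h'.symm⟩

instance : HasRep ℕ := ⟨repAtom, fun _ => ⟨_, rfl⟩, fun h h' =>
  Data.ofNat_injective (Eq.trans (Eq.symm h) h')⟩

/-- `nil` stands for false, every other tree for true. -/
instance : HasRep Prop where
  rep P d := d ≠ .nil ↔ P
  exists_rep P := by
    by_cases h : P
    · exact ⟨.cons .nil .nil, by simp [h]⟩
    · exact ⟨.nil, by simp [h]⟩
  rep_inj h h' := propext (h.symm.trans h')

instance {α β : Type} [HasRep α] [HasRep β] : HasRep (α × β) where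
  rep := (rep (α := α)).prod rep
  exists_rep := fun ⟨a, b⟩ => by
    obtain ⟨d, hd⟩ := exists_rep a
    obtain ⟨e, he⟩ := exists_rep b
    exact ⟨_, d, e, rfl, hd, he⟩
  rep_inj := by
    rintro ⟨a, b⟩ ⟨a', b'⟩ _ ⟨d, e, rfl, hd, he⟩ ⟨d', e', h, hd', he'⟩
    cases h
    exact Prod.ext (rep_inj hd hd') (rep_inj he he')

instance {α : Type} [HasRep α] : HasRep (Finset α) where
  rep := (rep (α := α)).finset
  exists_rep s := by
    choose r hr using exists_rep (α := α)
    refine ⟨_, s.toList.map r, rfl, fun e he => ?_, fun a ha => ⟨r a, ?_, hr a⟩⟩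
    · obtain ⟨a, ha, rfl⟩ := List.mem_map.1 he
      exact ⟨a, Finset.mem_toList.1 ha, hr a⟩
    · exact List.mem_map_of_mem (Finset.mem_toList.2 ha)
  rep_inj := by
    rintro s s' _ ⟨l, rfl, h₁, h₂⟩ ⟨l', h, h₁', h₂'⟩
    cases Data.ofList_injective h
    ext a
    constructor
    · intro ha
      obtain ⟨e, he, hae⟩ := h₂ a ha
      obtain ⟨a', ha', hae'⟩ := h₁' e he
      rwa [rep_inj hae hae']
    · intro ha
      obtain ⟨e, he, hae⟩ := h₂' a ha
      obtain ⟨a', ha', hae'⟩ := h₁ e he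
      rwa [rep_inj hae hae']

instance : HasRep Clause where
  rep := repClause
  exists_rep c := exists_rep (c.head, c.body)
  rep_inj h h' := by
    have := rep_inj (α := Finset ℕ × Finset ℕ) h h'
    exact Clause.ext (congrArg Prod.fst this) (congrArg Prod.snd this)

variable {α β γ : Type} [HasRep α] [HasRep β] [HasRep γ]

/-- `f` is computable in polynomial time. -/
def PTime (f : α → β) : Prop := PolyTimeOn rep rep Set.univ f

theorem pTime_iff {f : α → β} : PTime f ↔ ∃ (p : Prog) (q : Polynomial ℕ), ∀ a d, rep a d →
    ∃ e t, Runs p d e t ∧ rep (f a) e ∧ t ≤ q.eval d.size := by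
  simp [PTime, PolyTimeOn]

namespace PTime

/-- A function computed by a single instruction. -/
theorem of_instr {f : α → β} (p : Prog) (g : Data → Data) (h : ∀ d, Runs p d (g d) d.size)
    (hr : ∀ a d, rep a d → rep (f a) (g d)) : PTime f :=
  pTime_iff.2 ⟨p, .X, fun a d hd => ⟨g d, d.size, h d, hr a d hd, by simp⟩⟩

theorem id : PTime fun a : α => a := of_instr .id _ Runs.id fun _ _ h => h

/-- The intermediate result has size at most three times the time `q` spent on it, so the second
program takes time at most `q'(3q)`. -/
theorem comp {g : β → γ} {f : α → β} (hg : PTime g) (hf : PTime f) : PTime fun a => g (f a) := by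
  obtain ⟨p, q, h⟩ := pTime_iff.1 hf
  obtain ⟨p', q', h'⟩ := pTime_iff.1 hg
  refine pTime_iff.2 ⟨.seq p p', .X + q + q'.comp (3 * q), fun a d hd => ?_⟩
  obtain ⟨e, t, hr, he, ht⟩ := h a d hd
  obtain ⟨e', t', hr', he', ht'⟩ := h' _ e he
  refine ⟨e', _, .seq hr hr', he', ?_⟩
  have : q'.eval e.size ≤ q'.eval (3 * q.eval d.size) := eval_mono _ (by
    have := hr.size_le; omega)
  simp only [Polynomial.eval_add, Polynomial.eval_X, Polynomial.eval_comp, Polynomial.eval_mul,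
    Polynomial.eval_ofNat]
  omega

theorem pair {f : α → β} {g : α → γ} (hf : PTime f) (hg : PTime g) :
    PTime fun a => (f a, g a) := by
  obtain ⟨p, q, h⟩ := pTime_iff.1 hf
  obtain ⟨p', q', h'⟩ := pTime_iff.1 hg
  refine pTime_iff.2 ⟨.pair p p', .X + q + q', fun a d hd => ?_⟩
  obtain ⟨e, t, hr, he, ht⟩ := h a d hd
  obtain ⟨e', t', hr', he', ht'⟩ := h' a d hd
  refine ⟨_, _, .pair hr hr', ⟨e, e', rfl, he, he'⟩, ?_⟩
  simp only [Polynomial.eval_add, Polynomial.eval_X]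
  omega

/-- Representations of equal form are converted for free. -/
theorem of_rep {f : α → β} (h : ∀ a d, rep a d → rep (f a) d) : PTime f :=
  of_instr .id _ Runs.id h

theorem const (b : β) : PTime fun _ : α => b := by
  obtain ⟨d, hd⟩ := exists_rep b
  -- One fixed tree representing `b` is produced on every input; it is built by recursion on its
  -- structure.
  suffices h : PTime fun _ : α => d by
    obtain ⟨p, q, h⟩ := pTime_iff.1 h
    refine pTime_iff.2 ⟨p, q, fun a x hx => ?_⟩
    obtain ⟨e, t, hr, he, ht⟩ := h a x hx
    cases he
    exact ⟨d, t, hr, hd, ht⟩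
  clear hd
  induction d with
  | nil => exact of_instr .nil _ Runs.nil fun _ _ _ => rfl
  | cons l r hl hr =>
    refine comp (g := fun x : Data × Data => Data.cons x.1 x.2) (of_rep ?_) (hl.pair hr)
    rintro _ _ ⟨e, f, rfl, he, hf⟩
    cases he; cases hf; rfl

theorem data_left : PTime Data.left := of_instr .left _ Runs.left fun _ _ h => congrArg _ h

theorem data_right : PTime Data.right := of_instr .right _ Runs.right fun _ _ h => congrArg _ h

theorem data_cons {f g : α → Data} (hf : PTime f) (hg : PTime g) :
    PTime fun a => Data.cons (f a) (g a) := by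
  refine comp (g := fun x : Data × Data => Data.cons x.1 x.2) (of_rep ?_) (hf.pair hg)
  rintro _ _ ⟨e, f, rfl, he, hf⟩
  cases he; cases hf; rfl

theorem data_ne_nil : PTime fun d : Data => d ≠ .nil := of_rep fun a d h => by
  cases h; exact Iff.rfl

theorem fst : PTime (Prod.fst : α × β → α) := of_instr .left _ Runs.left (by
  rintro _ _ ⟨e, f, rfl, he, hf⟩; exact he)

theorem snd : PTime (Prod.snd : α × β → β) := of_instr .right _ Runs.right (by
  rintro _ _ ⟨e, f, rfl, he, hf⟩; exact hf)

theorem data_eq : PTime fun x : Data × Data => x.1 = x.2 := of_instr .eq _ Runs.eq (by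
  rintro ⟨a, b⟩ _ ⟨e, f, rfl, he, hf⟩
  cases he; cases hf
  by_cases h : a = b <;> simp [rep, Data.left, Data.right, h, Data.ofBool])

theorem ite {P : α → Prop} [DecidablePred P] {f g : α → β} (hP : PTime P) (hf : PTime f)
    (hg : PTime g) : PTime fun a => if P a then f a else g a := by
  obtain ⟨p₀, q₀, h₀⟩ := pTime_iff.1 hP
  obtain ⟨p, q, h⟩ := pTime_iff.1 hf
  obtain ⟨p', q', h'⟩ := pTime_iff.1 hg
  refine pTime_iff.2 ⟨.ite p₀ p p', .X + q₀ + q + q', fun a d hd => ?_⟩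
  obtain ⟨e₀, t₀, hr₀, he₀, ht₀⟩ := h₀ a d hd
  simp only [Polynomial.eval_add, Polynomial.eval_X]
  split_ifs with hPa
  · obtain ⟨e, t, hr, he, ht⟩ := h a d hd
    exact ⟨e, _, .ite_true hr₀ (he₀.2 hPa) hr, he, by omega⟩
  · obtain ⟨e, t, hr, he, ht⟩ := h' a d hd
    have : e₀ = .nil := by_contra fun hne => hPa (he₀.1 hne)
    subst this
    exact ⟨e, _, .ite_false hr₀ hr, he, by omega⟩

open scoped Classical in
theorem not {P : α → Prop} (hP : PTime P) : PTime fun a => ¬ P a := by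
  simpa using ite hP (const False) (const True)

open scoped Classical in
theorem and {P Q : α → Prop} (hP : PTime P) (hQ : PTime Q) : PTime fun a => P a ∧ Q a := by
  simpa using ite hP hQ (const False)

open scoped Classical in
theorem or {P Q : α → Prop} (hP : PTime P) (hQ : PTime Q) : PTime fun a => P a ∨ Q a := by
  have := ite hP (const True) hQ
  refine (congrArg PTime ?_).mp this
  funext a; by_cases h : P a <;> simp [h]

theorem imp {P Q : α → Prop} (hP : PTime P) (hQ : PTime Q) : PTime fun a => P a → Q a := by
  simpa only [imp_iff_not_or] using hP.not.or hQ

theorem nat_eq : PTime fun x : ℕ × ℕ => x.1 = x.2 := by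
  have h : PTime Data.ofNat := of_rep fun a d h => Eq.symm h
  have := data_eq.comp ((h.comp (fst (α := ℕ) (β := ℕ))).pair (h.comp snd))
  simpa only [Data.ofNat_injective.eq_iff] using this

end PTime

/-! ### Loops over lists -/

namespace PTime

/-- A loop whose number of rounds and whose intermediate results are polynomially bounded. -/
theorem data_while {b : Data → Prop} {g f : Data → Data} (hb : PTime b) (hg : PTime g)
    (T N : Polynomial ℕ)
    (h : ∀ d, ∃ n ≤ T.eval d.size, f d = g^[n] d ∧ ¬ b (g^[n] d) ∧ (∀ k < n, b (g^[k] d)) ∧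
      ∀ k ≤ n, (g^[k] d).size ≤ N.eval d.size) : PTime f := by
  obtain ⟨pb, qb, hb⟩ := pTime_iff.1 hb
  obtain ⟨pg, qg, hg⟩ := pTime_iff.1 hg
  refine pTime_iff.2 ⟨.while pb pg, (T + 1) * (N + qb.comp N + qg.comp N), fun a d had => ?_⟩
  cases had
  obtain ⟨n, hT, hf, hn, hlt, hN⟩ := h a
  have hqb : ∀ k ≤ n, qb.eval (g^[k] a).size ≤ qb.eval (N.eval a.size) :=
    fun k hk => eval_mono _ (hN k hk)
  have hqg : ∀ k ≤ n, qg.eval (g^[k] a).size ≤ qg.eval (N.eval a.size) :=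
    fun k hk => eval_mono _ (hN k hk)
  obtain ⟨e, t, hr, ⟨-, he⟩, ht⟩ := runs_while (b := pb) (p := pg)
    (C := (N + qb.comp N + qg.comp N).eval a.size)
    -- The invariant is indexed by the number `k` of rounds still to be made.
    (fun k d => k ≤ n ∧ d = g^[n - k] a) (by
      rintro d ⟨-, rfl⟩
      obtain ⟨e, t, hr, he, ht⟩ := hb (g^[n] a) _ rfl
      have : e = .nil := by_contra fun hne => hn (he.1 hne)
      subst this
      refine ⟨t, hr, ?_⟩
      have := hqb n le_rfl
      have := hN n le_rfl
      simp only [Polynomial.eval_add, Polynomial.eval_comp, Nat.sub_zero]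
      omega) (by
      rintro k d ⟨hk, rfl⟩
      obtain ⟨e, t, hr, he, ht⟩ := hb (g^[n - (k + 1)] a) _ rfl
      obtain ⟨e', t', hr', he', ht'⟩ := hg (g^[n - (k + 1)] a) _ rfl
      refine ⟨e, t, e', t', hr, he.2 (hlt _ (by omega)), hr', ⟨by omega, ?_⟩, ?_⟩
      · rw [← he', ← Function.iterate_succ_apply' g]
        congr 1; omega
      · have := hqb (n - (k + 1)) (by omega)
        have := hqg (n - (k + 1)) (by omega)
        have := hN (n - (k + 1)) (by omega)
        simp only [Polynomial.eval_add, Polynomial.eval_comp]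
        omega) n a ⟨le_rfl, by simp⟩
  refine ⟨e, t, hr, by simp [he, hf, rep], ht.trans ?_⟩
  rw [Polynomial.eval_mul]
  gcongr
  simpa using hT

/-- The list in the left subtree is reversed and put in front of the one in the right subtree. -/
theorem data_reverseAppend : PTime fun d : Data =>
    Data.ofList (d.left.toList.reverse ++ d.right.toList) := by
  -- One round moves the first entry of the left list to the front of the right list; the total size
  -- stays constant.
  let g : Data → Data := fun d => .cons d.left.right (.cons d.left.left d.right)
  have hg : PTime g := (data_right.comp data_left).data_cons
    ((data_left.comp data_left).data_cons data_right)
  have hit : ∀ (l : List Data) (e : Data),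
      g^[l.length] (.cons (.ofList l) e) = .cons .nil (.ofList (l.reverse ++ e.toList)) ∧
      (∀ k < l.length, (g^[k] (.cons (.ofList l) e)).left ≠ .nil) ∧
      ∀ k ≤ l.length, (g^[k] (.cons (.ofList l) e)).size = (Data.cons (.ofList l) e).size := by
    intro l
    induction l with
    | nil => simp [Data.ofList]
    | cons a l ih =>
      intro e
      obtain ⟨h₁, h₂, h₃⟩ := ih (.cons a e)
      refine ⟨by simpa [g, Data.ofList, Data.left, Data.right, Data.toList] using h₁, ?_, ?_⟩
      · rintro (_ | k) hk
        · simp [Data.ofList, Data.left]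
        · exact h₂ k (by simpa using hk)
      · rintro (_ | k) hk
        · rfl
        · refine (h₃ k (by simpa using hk)).trans ?_
          simp [Data.ofList, Data.size]; omega
  have := data_while (data_ne_nil.comp data_left) hg (f := fun d =>
    g^[d.left.toList.length] d) .X .X (fun d => by
      refine ⟨d.left.toList.length, ?_, rfl, ?_⟩
      · have := Data.length_lt_size_ofList d.left.toList
        have := d.size_left_le
        simp only [Data.ofList_toList] at *
        simp; omega
      · cases d with
        | nil => simp [Data.left, Data.toList]
        | cons l r =>
          obtain ⟨h₁, h₂, h₃⟩ := hit l.toList r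
          simp only [Data.ofList_toList] at *
          simp only [Data.left, h₁]
          exact ⟨by simp, h₂, fun k hk => by simp [h₃ k hk]⟩)
  refine (congrArg PTime ?_).mp (data_right.comp this)
  funext d
  cases d with
  | nil => rfl
  | cons l r => have := (hit l.toList r).1; simp_all [Data.left, Data.right]

end PTime

/-- A program that maps a list, element by element, to lists and collects the results. -/
theorem exists_prog_flatMap (p : Prog) (q : Polynomial ℕ) : ∃ (p' : Prog) (q' : Polynomial ℕ),
    ∀ (d : Data) (l : List Data) (F : Data → List Data),
      (∀ x ∈ l, ∃ t, Runs p (.cons d x) (.ofList (F x)) t ∧ t ≤ q.eval (Data.cons d x).size) →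
      ∃ t, Runs p' (.cons d (.ofList l)) (.ofList (l.flatMap F).reverse) t ∧
        t ≤ q'.eval (Data.cons d (.ofList l)).size := by
  obtain ⟨pi, qi, hi⟩ := pTime_iff.1 (PTime.data_left.data_cons
    (PTime.data_right.data_cons (PTime.const Data.nil)))
  obtain ⟨pb, qb, hb⟩ := pTime_iff.1 (PTime.data_ne_nil.comp
    (PTime.data_left.comp PTime.data_right))
  obtain ⟨px, qx, hx⟩ := pTime_iff.1 (PTime.data_left.data_cons
    (PTime.data_left.comp (PTime.data_left.comp PTime.data_right)))
  obtain ⟨pc, qc, hc⟩ := pTime_iff.1 ((PTime.data_left.comp PTime.data_left).data_cons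
    ((PTime.data_right.comp (PTime.data_left.comp
      (PTime.data_right.comp PTime.data_left))).data_cons
      (PTime.data_reverseAppend.comp (PTime.data_right.data_cons
        (PTime.data_right.comp (PTime.data_right.comp PTime.data_left))))))
  obtain ⟨pr, qr, hr⟩ := pTime_iff.1 (PTime.data_right.comp PTime.data_right)
  -- `N` bounds the loop state: there are at most `M` entries, where `M` is the input size, and each
  -- contributes at most `3 * q(M)` to the accumulated output. `C` bounds the cost of a round.
  let N : Polynomial ℕ := .X * (3 * q) + .X + 2
  let C : Polynomial ℕ := 5 * N + qb.comp N + qx.comp N + q + qc.comp (N + 3 * q + 1)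
  refine ⟨.seq pi (.seq (.while pb (.seq (.pair .id (.seq px p)) pc)) pr),
    .X + qi + N + (.X + 1) * C + qr.comp N, fun d l F hF => ?_⟩
  set M := (Data.cons d (.ofList l)).size with hM
  have hNM : N.eval M = M * (3 * q.eval M) + M + 2 := by simp [N]
  have hMd : M = d.size + (Data.ofList l).size + 1 := rfl
  -- The state holds the parameter `d`, the entries `l₂` still to be treated, and the reversed
  -- output for the entries `l₁` already treated.
  let st : List Data → List Data → Data := fun l₁ l₂ =>
    .cons d (.cons (.ofList l₂) (.ofList (l₁.flatMap F).reverse))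
  have hmem : ∀ x ∈ l, (Data.cons d x).size ≤ M := fun x hx => by
    have := Data.size_lt_of_mem hx
    simp only [Data.size]; omega
  have hFx : ∀ x ∈ l, (Data.ofList (F x)).size ≤ 3 * q.eval M := fun x hx => by
    obtain ⟨t, h, ht⟩ := hF x hx
    have := h.size_le
    have := eval_mono q (hmem x hx)
    omega
  have hacc : ∀ l₁ : List Data, (∀ x ∈ l₁, x ∈ l) →
      (Data.ofList (l₁.flatMap F).reverse).size ≤ l₁.length * (3 * q.eval M) + 1 := by
    intro l₁
    induction l₁ with
    | nil => simp [Data.ofList, Data.size]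
    | cons x l₁ ih =>
      intro h
      have h₁ := ih fun y hy => h y (List.mem_cons_of_mem _ hy)
      have h₂ := hFx x (h x List.mem_cons_self)
      have h₃ := Data.size_ofList_append (F x) (l₁.flatMap F)
      rw [Data.size_ofList_reverse] at h₁ ⊢
      rw [List.flatMap_cons, List.length_cons, Nat.succ_mul]
      omega
  have hst : ∀ l₁ l₂, l₁ ++ l₂ = l → (st l₁ l₂).size ≤ N.eval M := by
    rintro l₁ l₂ rfl
    have h₁ := hacc l₁ fun x hx => List.mem_append_left _ hx
    have h₂ := Data.size_ofList_append l₁ l₂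
    have h₃ := Data.length_lt_size_ofList l₁
    have h₄ : l₁.length * (3 * q.eval M) ≤ M * (3 * q.eval M) :=
      Nat.mul_le_mul_right _ (by omega)
    simp only [st, Data.size]
    omega
  obtain ⟨e, t, hrun, ⟨l₁, l₂, hl, hlen, rfl⟩, ht⟩ :=
    runs_while (b := pb) (p := .seq (.pair .id (.seq px p)) pc) (C := C.eval M)
    (fun n s => ∃ l₁ l₂, l₁ ++ l₂ = l ∧ l₂.length = n ∧ s = st l₁ l₂) (by
      rintro _ ⟨l₁, l₂, hl, hlen, rfl⟩
      obtain rfl := List.length_eq_zero_iff.1 hlen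
      obtain ⟨e, t, hr, he, ht⟩ := hb (st l₁ []) _ rfl
      have : e = .nil := by_contra fun hne => he.1 hne rfl
      subst this
      have h₁ := hst l₁ [] hl
      have h₂ := eval_mono qb h₁
      refine ⟨t, hr, ?_⟩
      simp only [C, Polynomial.eval_add, Polynomial.eval_mul, Polynomial.eval_comp,
        Polynomial.eval_ofNat]
      omega) (by
      rintro n _ ⟨l₁, l₂, hl, hlen, rfl⟩
      obtain ⟨x, l₂, rfl⟩ := List.exists_cons_of_length_eq_add_one hlen
      have hxl : x ∈ l := by simp [← hl]
      obtain ⟨e, t, hr, he, ht⟩ := hb _ _ rfl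
      obtain ⟨_, t₁, hr₁, rfl, ht₁⟩ := hx _ _ rfl
      obtain ⟨t₂, hr₂, ht₂⟩ := hF x hxl
      obtain ⟨_, t₃, hr₃, rfl, ht₃⟩ := hc _ _ rfl
      refine ⟨e, t, _, _, hr, he.2 (by simp [st, Data.right, Data.left, Data.ofList]),
        .seq (.pair (.id _) (.seq hr₁ hr₂)) hr₃,
        ⟨l₁ ++ [x], l₂, by simp [← hl], by simpa using hlen, ?_⟩, ?_⟩
      · simp [st, Data.right, Data.left, Data.ofList]
      · have h₁ := hst _ _ hl
        have h₂ := eval_mono qb h₁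
        have h₃ := eval_mono qx h₁
        have h₄ := eval_mono q (hmem x hxl)
        have h₅ := hFx x hxl
        have h₆ : qc.eval (Data.cons (st l₁ (x :: l₂)) (.ofList (F x))).size ≤
            qc.eval (N.eval M + 3 * q.eval M + 1) :=
          eval_mono qc (by simp only [Data.size] at h₁ ⊢; omega)
        simp only [C, Polynomial.eval_add, Polynomial.eval_mul, Polynomial.eval_comp,
          Polynomial.eval_ofNat, Polynomial.eval_one]
        omega) l.length (st [] l) ⟨[], l, rfl, rfl, rfl⟩
  obtain rfl := List.length_eq_zero_iff.1 hlen
  rw [List.append_nil] at hl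
  subst hl
  obtain ⟨_, t₀, hr₀, rfl, ht₀⟩ := hi _ (Data.cons d (.ofList l₁)) rfl
  obtain ⟨_, t₁, hr₁, rfl, ht₁⟩ := hr _ _ rfl
  rw [← hM] at ht₀
  refine ⟨_, .seq hr₀ (.seq hrun hr₁), ?_⟩
  have h₁ := hst l₁ [] (by simp)
  have h₂ := hst [] l₁ rfl
  have h₃ := eval_mono qr h₁
  have h₄ : (l₁.length + 1) * C.eval M ≤ (M + 1) * C.eval M := Nat.mul_le_mul_right _ (by
    have := Data.length_lt_size_ofList l₁; omega)
  have h₅ : (st [] l₁).size = (Data.cons d (.cons (.ofList l₁) .nil)).size := rfl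
  simp only [Polynomial.eval_add, Polynomial.eval_mul, Polynomial.eval_comp, Polynomial.eval_X,
    Polynomial.eval_one, Data.left, Data.right] at *
  omega

/-! ### Operations on finite sets -/

theorem rep_finset_iff {s : Finset β} {l : List Data} : rep s (Data.ofList l) ↔
    (∀ e ∈ l, ∃ b ∈ s, rep b e) ∧ ∀ b ∈ s, ∃ e ∈ l, rep b e := by
  constructor
  · rintro ⟨l', h, h'⟩
    cases Data.ofList_injective h
    exact h'
  · exact fun h => ⟨l, rfl, h⟩

theorem Data.exists_eq_ofList (d : Data) : ∃ l, d = .ofList l := ⟨d.toList, by simp⟩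

instance : Inhabited Data := ⟨.nil⟩

/-- A tree represents at most one element, so choosing an entry for each element is injective. This
makes the length of a list a sufficient number of rounds. -/
theorem card_le_length_of_rep {s : Finset β} {l : List Data} (h : rep s (Data.ofList l)) :
    s.card ≤ l.length := by
  choose! f hf using (rep_finset_iff.1 h).2
  refine (Finset.card_le_card_of_injOn f (t := l.toFinset)
    (fun b hb => by simpa using (hf b hb).1) fun b hb c hc hbc => ?_).trans l.toFinset_card_le
  exact rep_inj (hf b hb).2 (hbc ▸ (hf c hc).2)

namespace PTime

/-- Unions of polynomial-time computable families of finite sets. -/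
theorem collect {f : α → β → Finset γ} {s : α → Finset β} {t : α → Finset γ}
    (hf : PTime fun x : α × β => f x.1 x.2) (hs : PTime s)
    (ht : ∀ a c, c ∈ t a ↔ ∃ b ∈ s a, c ∈ f a b) : PTime t := by
  obtain ⟨p, q, hf⟩ := pTime_iff.1 hf
  obtain ⟨ps, qs, hs⟩ := pTime_iff.1 hs
  obtain ⟨p', q', h⟩ := exists_prog_flatMap p q
  refine pTime_iff.2 ⟨.seq (.pair .id ps) p', 3 * .X + qs + q'.comp (.X + 3 * qs + 1),
    fun a d had => ?_⟩
  obtain ⟨e, u, hr, he, hu⟩ := hs a d had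
  obtain ⟨l, rfl⟩ := Data.exists_eq_ofList e
  obtain ⟨h₁, h₂⟩ := rep_finset_iff.1 he
  have hx : ∀ x ∈ l, ∃ (L : List Data) (b : β), b ∈ s a ∧ rep b x ∧ rep (f a b) (Data.ofList L) ∧
      ∃ t, Runs p (.cons d x) (.ofList L) t ∧ t ≤ q.eval (Data.cons d x).size := by
    intro x hx
    obtain ⟨b, hb, hbx⟩ := h₁ x hx
    obtain ⟨e, t, hr, he, ht⟩ := hf (a, b) (.cons d x) ⟨d, x, rfl, had, hbx⟩
    obtain ⟨L, rfl⟩ := Data.exists_eq_ofList e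
    exact ⟨L, b, hb, hbx, he, t, hr, ht⟩
  choose! F b hF using hx
  obtain ⟨v, hv, hv'⟩ := h d l F fun x hx => (hF x hx).2.2.2
  -- Order and repetitions are irrelevant, so the concatenation of the lists for the sets `f a b`
  -- represents their union.
  refine ⟨_, _, .seq (.pair (.id _) hr) hv, rep_finset_iff.2 ⟨fun e he => ?_, fun c hc => ?_⟩, ?_⟩
  · obtain ⟨x, hx, hex⟩ := List.mem_flatMap.1 (List.mem_reverse.1 he)
    obtain ⟨hb, -, hrep, -⟩ := hF x hx
    obtain ⟨c, hc, hce⟩ := (rep_finset_iff.1 hrep).1 e hex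
    exact ⟨c, (ht a c).2 ⟨_, hb, hc⟩, hce⟩
  · obtain ⟨b', hb', hc'⟩ := (ht a c).1 hc
    obtain ⟨x, hx, hxb⟩ := h₂ b' hb'
    obtain ⟨hb, hbx, hrep, -⟩ := hF x hx
    rw [rep_inj hbx hxb] at hrep
    obtain ⟨e, he, hce⟩ := (rep_finset_iff.1 hrep).2 c hc'
    exact ⟨e, List.mem_reverse.2 (List.mem_flatMap.2 ⟨x, hx, he⟩), hce⟩
  · have := hr.size_le
    have : q'.eval (Data.cons d (.ofList l)).size ≤ q'.eval (d.size + 3 * qs.eval d.size + 1) :=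
      eval_mono _ (by simp only [Data.size]; omega)
    simp only [Polynomial.eval_add, Polynomial.eval_mul, Polynomial.eval_comp, Polynomial.eval_X,
      Polynomial.eval_one, Polynomial.eval_ofNat]
    omega

theorem finset_nonempty {s : α → Finset β} (hs : PTime s) : PTime fun a => (s a).Nonempty := by
  refine comp (g := Finset.Nonempty) (of_rep fun s d h => ?_) hs
  obtain ⟨l, rfl⟩ := Data.exists_eq_ofList d
  obtain ⟨h₁, h₂⟩ := rep_finset_iff.1 h
  constructor
  · intro hne
    cases l with
    | nil => exact absurd rfl hne
    | cons x l =>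
      obtain ⟨b, hb, -⟩ := h₁ x List.mem_cons_self
      exact ⟨b, hb⟩
  · rintro ⟨b, hb⟩ hnil
    obtain ⟨e, he, -⟩ := h₂ b hb
    cases l with
    | nil => simp at he
    | cons x l => simp [Data.ofList] at hnil

/-- The element of a one-element set. -/
theorem of_singleton {f : α → β} (h : PTime fun a => ({f a} : Finset β)) : PTime f := by
  suffices hs : ∀ (b : β) d, rep ({b} : Finset β) d → rep b d.left by
    obtain ⟨p, q, h⟩ := pTime_iff.1 h
    refine pTime_iff.2 ⟨.seq p .left, .X + q + 3 * q, fun a d had => ?_⟩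
    obtain ⟨e, t, hr, he, ht⟩ := h a d had
    refine ⟨_, _, .seq hr (.left _), hs _ _ he, ?_⟩
    have := hr.size_le
    simp only [Polynomial.eval_add, Polynomial.eval_mul, Polynomial.eval_X, Polynomial.eval_ofNat]
    omega
  intro b d h
  obtain ⟨l, rfl⟩ := Data.exists_eq_ofList d
  obtain ⟨h₁, h₂⟩ := rep_finset_iff.1 h
  cases l with
  | nil => obtain ⟨e, he, -⟩ := h₂ b (by simp); simp at he
  | cons x l =>
    obtain ⟨b', hb', hx⟩ := h₁ x List.mem_cons_self
    rw [Finset.mem_singleton.1 hb'] at hx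
    exact hx

theorem singleton {f : α → β} (hf : PTime f) : PTime fun a => ({f a} : Finset β) := by
  obtain ⟨p, q, h⟩ := pTime_iff.1 hf
  refine pTime_iff.2 ⟨.pair p .nil, 2 * .X + q, fun a d had => ?_⟩
  obtain ⟨e, t, hr, he, ht⟩ := h a d had
  refine ⟨_, _, .pair hr (.nil _), (rep_finset_iff (l := [e])).2 (by simpa using he), ?_⟩
  simp only [Polynomial.eval_add, Polynomial.eval_mul, Polynomial.eval_X, Polynomial.eval_ofNat]
  omega

theorem filter {P : α → β → Prop} [∀ a, DecidablePred (P a)] {s : α → Finset β} (hs : PTime s)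
    (hP : PTime fun x : α × β => P x.1 x.2) : PTime fun a => (s a).filter (P a) := by
  classical
  refine collect (f := fun a b => if P a b then {b} else ∅) (hP.ite snd.singleton (const ∅)) hs
    fun a c => ?_
  simp only [Finset.mem_filter]
  constructor
  · rintro ⟨h, h'⟩; exact ⟨c, h, by simp [h']⟩
  · rintro ⟨b, hb, h⟩
    split_ifs at h with hb'
    · cases Finset.mem_singleton.1 h; exact ⟨hb, hb'⟩
    · simp at h

theorem image [DecidableEq γ] {f : α → β → γ} {s : α → Finset β} (hs : PTime s)
    (hf : PTime fun x : α × β => f x.1 x.2) : PTime fun a => (s a).image (f a) :=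
  collect (f := fun a b => {f a b}) hf.singleton hs (by simp [eq_comm])

theorem biUnion [DecidableEq γ] {f : α → β → Finset γ} {s : α → Finset β} (hs : PTime s)
    (hf : PTime fun x : α × β => f x.1 x.2) : PTime fun a => (s a).biUnion (f a) :=
  collect hf hs (by simp)

theorem exists_mem {P : α → β → Prop} {s : α → Finset β} (hs : PTime s)
    (hP : PTime fun x : α × β => P x.1 x.2) : PTime fun a => ∃ b ∈ s a, P a b := by
  classical
  simpa only [Finset.filter_nonempty_iff] using (hs.filter hP).finset_nonempty

theorem forall_mem {P : α → β → Prop} {s : α → Finset β} (hs : PTime s)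
    (hP : PTime fun x : α × β => P x.1 x.2) : PTime fun a => ∀ b ∈ s a, P a b := by
  simpa using (exists_mem (P := fun a b => ¬ P a b) hs hP.not).not

theorem product {s : α → Finset β} {t : α → Finset γ} (hs : PTime s) (ht : PTime t) :
    PTime fun a => s a ×ˢ t a := by
  classical
  refine collect (f := fun a b => (t a).image fun c => (b, c)) (image (ht.comp fst)
    ((snd.comp fst).pair snd)) hs fun a c => ?_
  obtain ⟨b, c⟩ := c
  simp

theorem union [DecidableEq β] {s t : α → Finset β} (hs : PTime s) (ht : PTime t) :
    PTime fun a => s a ∪ t a := by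
  classical
  -- A binary union is a union over the two-element index set of truth values.
  refine collect (f := fun a P => if P then s a else t a) (s := fun _ => {True, False})
    (ite snd (hs.comp fst) (ht.comp fst)) (const _) fun a c => ?_
  simp only [Finset.mem_union, Finset.mem_insert, Finset.mem_singleton]
  constructor
  · rintro (h | h)
    · exact ⟨True, by simp, by simpa⟩
    · exact ⟨False, by simp, by simpa⟩
  · rintro ⟨P, -, h⟩
    split_ifs at h
    · exact .inl h
    · exact .inr h

end PTime

/-- A type with a polynomial-time equality test. -/
class HasRepEq (α : Type) [HasRep α] : Prop where
  pTime_eq : PTime fun x : α × α => x.1 = x.2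

instance : HasRepEq ℕ := ⟨PTime.nat_eq⟩

namespace PTime

theorem eq [HasRepEq β] {f g : α → β} (hf : PTime f) (hg : PTime g) :
    PTime fun a => f a = g a := HasRepEq.pTime_eq.comp (hf.pair hg)

end PTime

instance [HasRepEq α] [HasRepEq β] : HasRepEq (α × β) := ⟨by
  simpa only [Prod.ext_iff] using
    ((PTime.fst.comp PTime.fst).eq (PTime.fst.comp PTime.snd)).and
      ((PTime.snd.comp PTime.fst).eq (PTime.snd.comp (PTime.snd (α := α × β) (β := α × β))))⟩

namespace PTime

theorem mem [HasRepEq β] {f : α → β} {s : α → Finset β} (hf : PTime f) (hs : PTime s) :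
    PTime fun a => f a ∈ s a := by
  simpa using exists_mem (P := fun a b => f a = b) hs ((hf.comp fst).eq snd)

theorem inter [HasRepEq β] [DecidableEq β] {s t : α → Finset β} (hs : PTime s) (ht : PTime t) :
    PTime fun a => s a ∩ t a := by
  simpa only [Finset.filter_mem_eq_inter] using
    hs.filter (P := fun a b => b ∈ t a) (snd.mem (ht.comp fst))

theorem sdiff [HasRepEq β] [DecidableEq β] {s t : α → Finset β} (hs : PTime s) (ht : PTime t) :
    PTime fun a => s a \ t a := by
  simpa only [Finset.sdiff_eq_filter] using
    hs.filter (P := fun a b => b ∉ t a) (snd.mem (ht.comp fst)).not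

theorem subset [HasRepEq β] {s t : α → Finset β} (hs : PTime s) (ht : PTime t) :
    PTime fun a => s a ⊆ t a :=
  hs.forall_mem (snd.mem (ht.comp fst))

theorem ssubset [HasRepEq β] {s t : α → Finset β} (hs : PTime s) (ht : PTime t) :
    PTime fun a => s a ⊂ t a :=
  (hs.subset ht).and (ht.subset hs).not

end PTime

/-- Filtering by a program that does not lengthen the list. -/
theorem exists_prog_filter {P : α → β → Prop} [∀ a, DecidablePred (P a)]
    (hP : PTime fun x : α × β => P x.1 x.2) : ∃ (p : Prog) (q : Polynomial ℕ),
    ∀ a d (s : Finset β) e, rep a d → rep s e → ∃ e' t, Runs p (.cons d e) e' t ∧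
      rep (s.filter (P a)) e' ∧ e'.size ≤ e.size ∧ t ≤ q.eval (Data.cons d e).size := by
  classical
  obtain ⟨p, q, hP⟩ := pTime_iff.1 hP
  obtain ⟨p', q', h⟩ := exists_prog_flatMap (.ite p (.pair .right .nil) .nil) (4 * .X + q)
  refine ⟨p', q', fun a d s e had hs => ?_⟩
  obtain ⟨l, rfl⟩ := Data.exists_eq_ofList e
  obtain ⟨h₁, h₂⟩ := rep_finset_iff.1 hs
  -- `P a` is transferred from elements to trees; this is unambiguous on entries of `l` because a
  -- tree represents at most one element.
  let Q : Data → Prop := fun x => ∃ b ∈ s, rep b x ∧ P a b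
  obtain ⟨t, ht, ht'⟩ := h d l (fun x => if Q x then [x] else []) (fun x hx => by
    obtain ⟨b, hbs, hbx⟩ := h₁ x hx
    have hQ : Q x ↔ P a b := ⟨fun ⟨c, _, hc, hP⟩ => rep_inj hc hbx ▸ hP, fun h => ⟨b, hbs, hbx, h⟩⟩
    obtain ⟨e, t, hr, he, ht⟩ := hP (a, b) (.cons d x) ⟨d, x, rfl, had, hbx⟩
    simp only [Polynomial.eval_add, Polynomial.eval_mul, Polynomial.eval_X, Polynomial.eval_ofNat]
    split_ifs with hPa
    · exact ⟨_, .ite_true hr (he.2 (hQ.1 hPa)) (.pair (.right _) (.nil _)), by omega⟩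
    · have : e = .nil := by_contra fun hne => hPa (hQ.2 (he.1 hne))
      subst this
      exact ⟨_, .ite_false hr (.nil _), by omega⟩)
  have hfl : (l.flatMap fun x => if Q x then [x] else []) = l.filter fun x => Q x := by
    clear * -
    induction l with
    | nil => rfl
    | cons x l ih => rw [List.flatMap_cons, ih]; by_cases hx : Q x <;> simp [hx]
  rw [hfl] at ht
  refine ⟨_, t, ht, rep_finset_iff.2 ⟨fun e he => ?_, fun b hb => ?_⟩, ?_, ht'⟩
  · obtain ⟨-, hQ⟩ := List.mem_filter.1 (List.mem_reverse.1 he)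
    obtain ⟨b, hb, hbe, hPb⟩ := of_decide_eq_true hQ
    exact ⟨b, Finset.mem_filter.2 ⟨hb, hPb⟩, hbe⟩
  · obtain ⟨hb, hPb⟩ := Finset.mem_filter.1 hb
    obtain ⟨e, he, hbe⟩ := h₂ b hb
    exact ⟨e, List.mem_reverse.2 (List.mem_filter.2 ⟨he, decide_eq_true ⟨b, hb, hbe, hPb⟩⟩), hbe⟩
  · rw [Data.size_ofList_reverse]
    exact Data.size_ofList_le_of_sublist List.filter_sublist

/-- Iteration of a polynomial-time operation on the subsets of a polynomial-time computable set,
as often as this set has elements, or more often. -/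
theorem PTime.iterate [HasRepEq β] {g : α → Finset β → Finset β} {B i R : α → Finset β}
    (hg : PTime fun x : α × Finset β => g x.1 x.2) (hB : PTime B) (hi : PTime i)
    (hiB : ∀ a, i a ⊆ B a) (hgB : ∀ a s, s ⊆ B a → g a s ⊆ B a)
    (hR : ∀ a n, (B a).card ≤ n → (g a)^[n] (i a) = R a) : PTime R := by
  classical
  obtain ⟨pB, qB, hB⟩ := pTime_iff.1 hB
  obtain ⟨pi, qi, hi⟩ := pTime_iff.1 hi
  -- The next set is obtained by filtering the list for `B a` by membership in `g a s`. A list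
  -- computed directly for `g a s` may contain repetitions and grow polynomially in each round,
  -- which would not stay polynomial under iteration; the filtered list is never larger than the one
  -- for `B a`.
  obtain ⟨pf, qf, hf⟩ := exists_prog_filter
    (P := fun (x : (α × Finset β) × Finset β) b => b ∈ g x.1.1 x.2)
    (snd.mem (hg.comp ((fst.comp (fst.comp fst)).pair (snd.comp fst))))
  obtain ⟨pb, qb, hb⟩ := pTime_iff.1 (data_ne_nil.comp (data_left.comp data_right))
  obtain ⟨pA, qA, hA⟩ := pTime_iff.1 ((data_left.data_cons
    (data_right.comp data_right)).data_cons (data_right.comp data_left))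
  obtain ⟨pT, qT, hT⟩ := pTime_iff.1 (data_right.comp (data_left.comp data_right))
  let A : Polynomial ℕ := 3 * qB + 3 * qi
  let N : Polynomial ℕ := .X + 9 * qB + A + 3
  let C : Polynomial ℕ := 5 * N + qb.comp N + qT.comp N + qA.comp N + qf.comp N
  refine pTime_iff.2 ⟨.seq (.seq (.pair .id pB) (.pair .id (.pair .right (.seq .left pi))))
    (.seq (.while pb (.pair .left (.pair pT (.seq pA pf)))) (.seq .right .right)),
    4 * .X + qB + 5 * N + qi + (N + 1) * C + 4 * N, fun a d had => ?_⟩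
  obtain ⟨eB, tB, hrB, heB, htB⟩ := hB a d had
  obtain ⟨ei, ti, hri, hei, hti⟩ := hi a d had
  obtain ⟨l, rfl⟩ := Data.exists_eq_ofList eB
  have hszB := hrB.size_le
  have hszi := hri.size_le
  set M := d.size
  have hNM : N.eval M = M + 9 * qB.eval M + (3 * qB.eval M + 3 * qi.eval M) + 3 := by
    simp [N, A]
  -- The list `l` for `B a` is kept intact for filtering, and a second copy serves as a counter that
  -- loses one entry per round; `e` represents the current set.
  let st : List Data → Data → Data := fun l₂ e =>
    .cons (.cons d (.ofList l)) (.cons (.ofList l₂) e)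
  have hst : ∀ l₁ l₂ e, l₁ ++ l₂ = l → e.size ≤ A.eval M →
      (st l₂ e).size + (Data.ofList l).size ≤ N.eval M := by
    rintro l₁ l₂ e rfl he
    have h₁ := Data.size_ofList_append l₁ l₂
    have h₂ := (Data.ofList l₁).size_pos
    have hA : A.eval M = 3 * qB.eval M + 3 * qi.eval M := by simp [A]
    simp only [st, Data.size]
    omega
  have hsub : ∀ n, (g a)^[n] (i a) ⊆ B a := by
    intro n
    induction n with
    | zero => exact hiB a
    | succ n ih => rw [Function.iterate_succ_apply']; exact hgB a _ ih
  have hAM : A.eval M = 3 * qB.eval M + 3 * qi.eval M := by simp [A]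
  obtain ⟨_, t, hrun, ⟨l₁, l₂, e, hl, hlen, rfl, hsz, he⟩, ht⟩ :=
    runs_while (b := pb) (p := .pair .left (.pair pT (.seq pA pf))) (C := C.eval M)
    (fun n s => ∃ l₁ l₂ e, l₁ ++ l₂ = l ∧ l₂.length = n ∧ s = st l₂ e ∧ e.size ≤ A.eval M ∧
      rep ((g a)^[l₁.length] (i a)) e) (by
      rintro _ ⟨l₁, l₂, e, hl, hlen, rfl, hsz, he⟩
      obtain rfl := List.length_eq_zero_iff.1 hlen
      obtain ⟨v, t, hr, hv, ht⟩ := hb (st [] e) _ rfl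
      have : v = .nil := by_contra fun hne => hv.1 hne rfl
      subst this
      have h₁ : (st [] e).size ≤ N.eval M := by have := hst _ _ _ hl hsz; omega
      have h₂ := eval_mono qb h₁
      refine ⟨t, hr, ?_⟩
      simp only [C, Polynomial.eval_add, Polynomial.eval_mul, Polynomial.eval_comp,
        Polynomial.eval_ofNat]
      omega) (by
      rintro n _ ⟨l₁, l₂, e, hl, hlen, rfl, hsz, he⟩
      obtain ⟨x, l₂, rfl⟩ := List.exists_cons_of_length_eq_add_one hlen
      obtain ⟨v, t, hr, hv, ht⟩ := hb (st (x :: l₂) e) _ rfl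
      obtain ⟨_, t₁, hr₁, rfl, ht₁⟩ := hA (st (x :: l₂) e) _ rfl
      obtain ⟨_, t₂, hr₂, rfl, ht₂⟩ := hT (st (x :: l₂) e) _ rfl
      obtain ⟨e', t₃, hr₃, he', hsz', ht₃⟩ := hf ((a, B a), (g a)^[l₁.length] (i a))
        (.cons (.cons d (.ofList l)) e) (B a) (.ofList l)
        ⟨_, _, rfl, ⟨_, _, rfl, had, heB⟩, he⟩ heB
      refine ⟨v, t, _, _, hr, hv.2 (by simp [st, Data.right, Data.left, Data.ofList]),
        .pair (.left _) (.pair hr₂ (.seq hr₁ hr₃)),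
        ⟨l₁ ++ [x], l₂, e', by simp [← hl], by simpa using hlen, rfl, by omega, ?_⟩, ?_⟩
      · convert he' using 1
        rw [List.length_append, List.length_singleton, Function.iterate_succ_apply',
          Finset.filter_mem_eq_inter, Finset.inter_eq_right.2 (hgB a _ (hsub _))]
      · have h₀ := hst _ _ _ hl hsz
        have h₁ : (st (x :: l₂) e).size ≤ N.eval M := by omega
        have h₂ := eval_mono qb h₁
        have h₃ := eval_mono qA h₁
        have h₄ := eval_mono qT h₁
        have h₅ : qf.eval (Data.cons (.cons (.cons d (.ofList l)) e) (.ofList l)).size ≤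
            qf.eval (N.eval M) := eval_mono qf (by
          have := (Data.ofList (x :: l₂)).size_pos
          simp only [st, Data.size] at h₀ ⊢; omega)
        have h₆ : (Data.cons (.cons (.cons d (.ofList l)) e) (.ofList l)).size ≤ N.eval M := by
          have := (Data.ofList (x :: l₂)).size_pos
          simp only [st, Data.size] at h₀ ⊢; omega
        simp only [C, Polynomial.eval_add, Polynomial.eval_mul, Polynomial.eval_comp,
          Polynomial.eval_ofNat]
        omega) l.length (st l ei) ⟨[], l, ei, rfl, rfl, rfl, by omega, hei⟩
  obtain rfl := List.length_eq_zero_iff.1 hlen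
  rw [List.append_nil] at hl
  subst hl
  -- The number of rounds is the length of a list that may repeat elements; this is why `hR` speaks
  -- of all `n` from the cardinality upwards.
  rw [hR a _ (card_le_length_of_rep heB)] at he
  have h₁ := hst l₁ [] e (by simp) hsz
  have h₂ := hst [] l₁ ei rfl (by omega)
  have hlt := Data.length_lt_size_ofList l₁
  have h₄ : (l₁.length + 1) * C.eval M ≤ (N.eval M + 1) * C.eval M :=
    Nat.mul_le_mul_right _ (by omega)
  refine ⟨e, _, .seq (.seq (.pair (.id _) hrB)
    (.pair (.id _) (.pair (.right _) (.seq (.left _) hri))))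
    (.seq hrun (.seq (.right _) (.right _))), he, ?_⟩
  simp only [Polynomial.eval_add, Polynomial.eval_mul, Polynomial.eval_X, Polynomial.eval_one,
    Polynomial.eval_ofNat, st, Data.left, Data.right, Data.size, ← show M = d.size from rfl] at *
  omega

/-! ### Iterations that reach a fixed point -/

/-- Each step that is not stationary adds an element of `B`, so a fixed point is reached after at
most `B.card` steps. The iterates stay inside `R`, and every fixed point above `i` contains `R`. -/
theorem iterate_eq_of_inflationary {ι : Type} {g : Finset ι → Finset ι} {B i R : Finset ι}
    (hg : ∀ s ⊆ B, s ⊆ g s ∧ g s ⊆ B) (hi : i ⊆ B) (hiR : i ⊆ R) (hR : ∀ s ⊆ R, g s ⊆ R)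
    (hfix : ∀ s, i ⊆ s → g s = s → R ⊆ s) {n : ℕ} (hn : B.card ≤ n) : g^[n] i = R := by
  have key : ∀ n s, s ⊆ B → B.card ≤ s.card + n → g (g^[n] s) = g^[n] s := by
    intro n
    induction n with
    | zero =>
      intro s hs hc
      obtain rfl := Finset.eq_of_subset_of_card_le hs hc
      exact (hg s hs).2.antisymm (hg s hs).1
    | succ n ih =>
      intro s hs hc
      by_cases h : g s = s
      · rw [Function.iterate_fixed h, h]
      · rw [Function.iterate_succ_apply]
        refine ih _ (hg s hs).2 ?_
        have := Finset.card_lt_card ((hg s hs).1.ssubset_of_ne (Ne.symm h))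
        omega
  have hinv : ∀ n, i ⊆ g^[n] i ∧ g^[n] i ⊆ B ∧ g^[n] i ⊆ R := by
    intro n
    induction n with
    | zero => exact ⟨subset_rfl, hi, hiR⟩
    | succ n ih =>
      rw [Function.iterate_succ_apply']
      obtain ⟨h₁, h₂, h₃⟩ := ih
      exact ⟨h₁.trans (hg _ h₂).1, (hg _ h₂).2, hR _ h₃⟩
  exact (hinv n).2.2.antisymm (hfix _ (hinv n).1 (key n i hi (by omega)))

/-- A recursive function `F` that unfolds along `g` is thereby computed by iteration: each
non-stationary step loses an element, and at a fixed point `F` returns its argument. -/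
theorem iterate_eq_of_deflationary {ι : Type} {g F : Finset ι → Finset ι} (hg : ∀ s, g s ⊆ s)
    (hF : ∀ s, F (g s) = F s) (hfix : ∀ s, g s = s → F s = s) :
    ∀ (n : ℕ) (s : Finset ι), s.card ≤ n → g^[n] s = F s := by
  intro n
  induction n with
  | zero =>
    intro s hs
    obtain rfl := Finset.card_eq_zero.1 (Nat.le_zero.1 hs)
    exact (hfix _ (Finset.subset_empty.1 (hg _))).symm
  | succ n ih =>
    intro s hs
    by_cases h : g s = s
    · rw [Function.iterate_fixed h, hfix s h]
    · rw [Function.iterate_succ_apply, ih _ ?_, hF]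
      have := Finset.card_lt_card ((hg s).ssubset_of_ne h)
      omega

/-! ### Clauses and theories -/

namespace PTime

theorem clause_head : PTime Clause.head := of_instr .left _ Runs.left (by
  rintro c _ ⟨e, f, rfl, he, hf⟩; exact he)

theorem clause_body : PTime Clause.body := of_instr .right _ Runs.right (by
  rintro c _ ⟨e, f, rfl, he, hf⟩; exact hf)

theorem clause_mk {H B : α → Finset ℕ} (hH : PTime H) (hB : PTime B) :
    PTime fun a => Clause.mk (H a) (B a) :=
  comp (g := fun x : Finset ℕ × Finset ℕ => Clause.mk x.1 x.2) (of_rep fun _ _ h => h)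
    (hH.pair hB)

theorem clause_atoms : PTime Clause.atoms := clause_head.union clause_body

theorem clause_disjunctive : PTime Clause.Disjunctive := by
  have : PTime fun c : Clause => ∃ a ∈ c.head, ∃ b ∈ c.head, a ≠ b :=
    clause_head.exists_mem ((clause_head.comp fst).exists_mem ((snd.comp fst).eq snd).not)
  exact (congrArg PTime (funext fun c => propext Finset.one_lt_card.symm)).mp this

theorem theory_atoms : PTime Theory.atoms := id.biUnion (clause_atoms.comp snd)

theorem theory_nonDisjunctive : PTime Theory.NonDisjunctive :=
  id.forall_mem (clause_disjunctive.comp snd).not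

theorem theory_nd : PTime Theory.nd := by
  classical exact id.filter (clause_disjunctive.comp snd).not

theorem theory_projHead : PTime fun x : Theory × Finset ℕ => x.1.projHead x.2 :=
  (fst.image (clause_mk ((clause_head.comp snd).inter (snd.comp fst))
    (clause_body.comp snd))).filter (clause_head.comp snd).finset_nonempty

theorem theory_proj : PTime fun x : Theory × Finset ℕ => x.1.proj x.2 :=
  (fst.image (clause_mk ((clause_head.comp snd).inter (snd.comp fst))
    ((clause_body.comp snd).inter (snd.comp fst)))).filter (clause_head.comp snd).finset_nonempty

/-- Forward chaining: starting from the empty set, the heads of Horn clauses whose bodies have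
already been derived are added until nothing changes. -/
theorem steadySet : PTime fun x : Theory × Finset ℕ => x.1.steadySet x.2 := by
  classical
  refine iterate (B := Prod.snd) (i := fun _ => ∅) (g := fun x S => S ∪ x.2.filter fun a =>
    ∃ c ∈ (x.1.projHead x.2).nd, a ∈ c.head ∧ c.body ⊆ S) ?_ snd (const ∅) (by simp)
    (fun x s hs => Finset.union_subset hs (Finset.filter_subset _ _)) ?_
  · refine snd.union ((snd.comp fst).filter (exists_mem
      (theory_nd.comp (theory_projHead.comp (fst.comp fst))) (and ?_ ?_)))
    · exact (snd.comp fst).mem (clause_head.comp snd)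
    · exact (clause_body.comp snd).subset (snd.comp (fst.comp fst))
  · rintro ⟨T, M⟩ n hn
    refine iterate_eq_of_inflationary (fun s hs => ⟨Finset.subset_union_left,
      Finset.union_subset hs (Finset.filter_subset _ _)⟩) (Finset.empty_subset _)
      (Finset.empty_subset _) (fun s hs => Finset.union_subset hs ?_) ?_ hn
    · intro a ha
      obtain ⟨-, c, hc, hac, hcs⟩ := Finset.mem_filter.1 ha
      rcases Theory.steadySet_sat T M c hc with ⟨a', ha', h⟩ | ⟨b, hb, h⟩
      · have hcard := (Finset.mem_filter.1 hc).2
        rwa [Finset.card_le_one.1 (not_lt.1 hcard) a hac a' ha']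
      · exact absurd (hs (hcs hb)) h
    · intro s _ hs
      refine Theory.steadySet_subset_of_sat fun c hc => ?_
      by_cases hb : c.body ⊆ s
      · obtain ⟨hi, a, ha⟩ := Finset.mem_filter.1 (Finset.mem_filter.1 hc).1
        obtain ⟨c₀, -, rfl⟩ := Finset.mem_image.1 hi
        refine .inl ⟨a, ha, ?_⟩
        rw [← hs]
        exact Finset.mem_union_right _ (Finset.mem_filter.2
          ⟨(Finset.mem_inter.1 ha).2, _, hc, ha, hb⟩)
      · obtain ⟨b, hb⟩ := Finset.not_subset.1 hb
        exact .inr ⟨b, hb⟩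

theorem theory_simpl : PTime fun x : Theory × Finset ℕ => x.1.simpl x.2 := by
  classical
  have h : PTime fun x : (Theory × Finset ℕ) × Clause =>
      Disjoint x.2.head (x.1.1.steadySet x.1.2) := by
    have h : PTime fun x : (Theory × Finset ℕ) × Clause =>
        ∀ a ∈ x.2.head, a ∉ x.1.1.steadySet x.1.2 :=
      (clause_head.comp snd).forall_mem (snd.mem (steadySet.comp (fst.comp fst))).not
    exact (congrArg PTime (funext fun x => propext (by rw [Finset.disjoint_left]))).mp h
  unfold Theory.simpl
  exact fst.filter (h.and ((clause_body.comp snd).subset (snd.comp fst)))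

theorem theory_ssimpl : PTime fun x : Theory × Finset ℕ => x.1.ssimpl x.2 := by
  have h := theory_proj.comp (theory_simpl.pair (snd.sdiff steadySet))
  exact h

/-! ### Graphs -/

theorem reach : PTime fun x : Finset (ℕ × ℕ) × (ℕ × ℕ) => Reach x.1 x.2.1 x.2.2 := by
  classical
  -- The node set is not part of the input; the start node and the targets of all arcs contain
  -- everything reachable.
  let B : Finset (ℕ × ℕ) × ℕ → Finset ℕ := fun x => {x.2} ∪ x.1.image Prod.snd
  have h : PTime fun x : Finset (ℕ × ℕ) × ℕ => (B x).filter (Reach x.1 x.2) := by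
    refine iterate (B := B) (i := fun x => {x.2})
      (g := fun x s => s ∪ (x.1.filter fun e => e.1 ∈ s).image Prod.snd) ?_
      (snd.singleton.union (fst.image (snd.comp snd))) snd.singleton
      (fun x => Finset.subset_union_left) (fun x s hs => Finset.union_subset hs
        ((Finset.image_subset_image (Finset.filter_subset _ _)).trans
          Finset.subset_union_right)) ?_
    · exact snd.union (((fst.comp fst).filter ((fst.comp snd).mem (snd.comp fst))).image
        (snd.comp snd))
    · rintro ⟨E, u⟩ n hn
      refine iterate_eq_of_inflationary (fun s hs => ⟨Finset.subset_union_left,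
        Finset.union_subset hs ((Finset.image_subset_image (Finset.filter_subset _ _)).trans
          Finset.subset_union_right)⟩) Finset.subset_union_left ?_
        (fun s hs => Finset.union_subset hs ?_) ?_ hn
      · exact Finset.singleton_subset_iff.2 (Finset.mem_filter.2
          ⟨Finset.mem_union_left _ (Finset.mem_singleton_self _), .refl⟩)
      · intro w hw
        obtain ⟨⟨v, w⟩, he, rfl⟩ := Finset.mem_image.1 hw
        obtain ⟨he, hv⟩ := Finset.mem_filter.1 he
        exact Finset.mem_filter.2 ⟨Finset.mem_union_right _ (Finset.mem_image_of_mem _ he),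
          (Finset.mem_filter.1 (hs hv)).2.tail he⟩
      · intro s hu hs v hv
        have hr : Reach E u v := (Finset.mem_filter.1 hv).2
        induction hr with
        | refl => exact hu (Finset.mem_singleton_self _)
        | @tail v w huv hvw ih =>
          have hvB : v ∈ B (E, u) := by
            rcases Relation.ReflTransGen.cases_tail huv with rfl | ⟨c, -, hc⟩
            · exact Finset.mem_union_left _ (Finset.mem_singleton_self _)
            · exact Finset.mem_union_right _ (Finset.mem_image_of_mem _ hc)
          rw [← hs]
          exact Finset.mem_union_right _ (Finset.mem_image.2 ⟨(v, w), Finset.mem_filter.2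
            ⟨hvw, ih (Finset.mem_filter.2 ⟨hvB, huv⟩)⟩, rfl⟩)
  have h' : PTime fun x : Finset (ℕ × ℕ) × (ℕ × ℕ) =>
      x.2.2 ∈ (B (x.1, x.2.1)).filter (Reach x.1 x.2.1) :=
    (snd.comp snd).mem (h.comp (fst.pair (fst.comp snd)))
  refine (congrArg PTime ?_).mp h'
  funext ⟨E, u, v⟩
  refine propext ⟨fun h => (Finset.mem_filter.1 h).2, fun h => Finset.mem_filter.2 ⟨?_, h⟩⟩
  dsimp only at h ⊢
  rcases Relation.ReflTransGen.cases_tail h with rfl | ⟨c, -, hc⟩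
  · exact Finset.mem_union_left _ (Finset.mem_singleton_self _)
  · exact Finset.mem_union_right _ (Finset.mem_image_of_mem _ hc)

theorem reach' {E : α → Finset (ℕ × ℕ)} {u v : α → ℕ} (hE : PTime E) (hu : PTime u)
    (hv : PTime v) : PTime fun a => Reach (E a) (u a) (v a) :=
  reach.comp (hE.pair (hu.pair hv))

theorem stronglyConnected {X : α → Finset ℕ} {E : α → Finset (ℕ × ℕ)} (hX : PTime X)
    (hE : PTime E) : PTime fun a => StronglyConnected (X a) (E a) :=
  hX.forall_mem ((hX.comp fst).forall_mem
    (reach' (hE.comp (fst.comp fst)) (snd.comp fst) snd))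

theorem component {X : α → Finset ℕ} {E : α → Finset (ℕ × ℕ)} {u : α → ℕ} (hX : PTime X)
    (hE : PTime E) (hu : PTime u) : PTime fun a => component (X a) (E a) (u a) := by
  classical exact hX.filter ((reach' (hE.comp fst) (hu.comp fst) snd).and
    (reach' (hE.comp fst) snd (hu.comp fst)))

theorem lastLevel {X : α → Finset ℕ} {E : α → Finset (ℕ × ℕ)} (hX : PTime X) (hE : PTime E) :
    PTime fun a => lastLevel (X a) (E a) := by
  classical
  have hC : PTime fun x : α × ℕ => MinModel.component (X x.1) (E x.1) x.2 :=
    component (hX.comp fst) (hE.comp fst) snd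
  refine hX.filter (hC.forall_mem ((hX.comp (fst.comp fst)).forall_mem (imp ?_ ?_)))
  · exact ((snd.comp fst).pair snd).mem (hE.comp (fst.comp (fst.comp fst)))
  · exact snd.mem (hC.comp (fst.comp fst))

end PTime

/-! ### Elementary subgraphs -/

theorem Reach.mono {E E' : Finset (ℕ × ℕ)} (h : E ⊆ E') {u v : ℕ} (hr : Reach E u v) :
    Reach E' u v :=
  Relation.ReflTransGen.mono (fun _ _ he => h he) _ _ hr

/-- Besides polynomial-time decidability, this monotonicity is all that is used about the body test,
so both variants are treated at once. -/
theorem BodyTest.Holds.mono {test : BodyTest} {E E' : Finset (ℕ × ℕ)} {c : Clause} (h : E ⊆ E')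
    (hc : test.Holds E c) : test.Holds E' c := by
  cases test with
  | sameComponent => exact fun u hu v hv => (hc u hu v hv).mono h
  | inducedSubgraph =>
    exact fun u hu v hv => (hc u hu v hv).mono (Finset.filter_subset_filter _ h)

theorem mem_arcs {T : Theory} {e : ℕ × ℕ} :
    e ∈ arcs T ↔ ∃ c ∈ T, e.1 ∈ c.body ∧ e.2 ∈ c.head := by
  simp [arcs]

open scoped Classical in
theorem subset_elemLoop (test : BodyTest) (T : Theory) (E : Finset (ℕ × ℕ)) :
    E ⊆ elemLoop test T E := by
  induction T, E using elemLoop.induct (test := test) with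
  | case1 =>
    rename_i T E C h
    rw [elemLoop, if_pos h]
  | case2 =>
    rename_i T E C h ih
    rw [elemLoop, if_neg h]
    exact Finset.subset_union_left.trans ih

open scoped Classical in
/-- The elementary subgraph is closed under the clauses that pass the test. -/
theorem arcs_subset_elemLoop {test : BodyTest} {T : Theory} {E : Finset (ℕ × ℕ)} {c : Clause}
    (hc : c ∈ T) (h : test.Holds (elemLoop test T E) c) :
    c.body ×ˢ c.head ⊆ elemLoop test T E := by
  induction T, E using elemLoop.induct (test := test) with
  | case1 T E C hC =>
    rw [elemLoop, if_pos hC] at h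
    have : c ∈ C := Finset.mem_filter.2 ⟨hc, h⟩
    simp [hC] at this
  | case2 T E C hC ih =>
    rw [elemLoop, if_neg hC] at h ⊢
    by_cases hcC : c ∈ C
    · refine subset_trans ?_ (Finset.subset_union_right.trans (subset_elemLoop _ _ _))
      exact fun e he => mem_arcs.2 ⟨c, hcC, Finset.mem_product.1 he⟩
    · exact ih (Finset.mem_sdiff.2 ⟨hc, hcC⟩) h

open scoped Classical in
-- Monotonicity of the test carries each round into `R`. With `arcs_subset_elemLoop` this makes the
-- loop started on `∅` compute the least arc set closed under the clauses that pass, so discarding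
-- used clauses is immaterial and an iteration without discarding gives the same graph.
theorem elemLoop_subset {test : BodyTest} {T : Theory} {E R : Finset (ℕ × ℕ)} (hE : E ⊆ R)
    (hR : ∀ c ∈ T, test.Holds R c → c.body ×ˢ c.head ⊆ R) : elemLoop test T E ⊆ R := by
  induction T, E using elemLoop.induct (test := test) with
  | case1 T E C h => rwa [elemLoop, if_pos h]
  | case2 T E C h ih =>
    rw [elemLoop, if_neg h]
    refine ih (Finset.union_subset hE fun e he => ?_) fun c hc => hR c (Finset.mem_sdiff.1 hc).1
    obtain ⟨c, hc, hec⟩ := mem_arcs.1 he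
    obtain ⟨hcT, hct⟩ := Finset.mem_filter.1 hc
    exact hR c hcT (hct.mono hE) (Finset.mem_product.2 hec)

namespace PTime

theorem bodyTest_holds (test : BodyTest) :
    PTime fun x : Finset (ℕ × ℕ) × Clause => test.Holds x.1 x.2 := by
  cases test with
  | sameComponent => exact stronglyConnected (clause_body.comp snd) fst
  | inducedSubgraph =>
    refine stronglyConnected (clause_body.comp snd) (fst.filter (and ?_ ?_))
    · exact (fst.comp snd).mem (clause_body.comp (snd.comp fst))
    · exact (snd.comp snd).mem (clause_body.comp (snd.comp fst))

theorem arcs : PTime arcs :=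
  id.biUnion ((clause_body.comp snd).product (clause_head.comp snd))

theorem elemArcs (test : BodyTest) :
    PTime fun x : Theory × Finset ℕ => elemArcs test x.1 x.2 := by
  classical
  have h : PTime fun T : Theory => elemLoop test T ∅ := by
    refine iterate (B := MinModel.arcs) (i := fun _ => ∅)
      (g := fun T E => E ∪ MinModel.arcs (T.filter fun c => test.Holds E c))
      (snd.union (arcs.comp (fst.filter ((bodyTest_holds test).comp ((snd.comp fst).pair snd)))))
      arcs (const ∅) (by simp) ?_ ?_
    · exact fun T s hs => Finset.union_subset hs
        (Finset.biUnion_subset_biUnion_of_subset_left _ (Finset.filter_subset _ _))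
    · intro T n hn
      refine iterate_eq_of_inflationary (fun s hs => ⟨Finset.subset_union_left,
        Finset.union_subset hs
          (Finset.biUnion_subset_biUnion_of_subset_left _ (Finset.filter_subset _ _))⟩)
        (Finset.empty_subset _) (Finset.empty_subset _)
        (fun s hs => Finset.union_subset hs fun e he => ?_) (fun s _ hs => ?_) hn
      · obtain ⟨c, hc, hec⟩ := mem_arcs.1 he
        obtain ⟨hcT, hct⟩ := Finset.mem_filter.1 hc
        exact arcs_subset_elemLoop hcT (hct.mono hs) (Finset.mem_product.2 hec)
      · refine elemLoop_subset (Finset.empty_subset _) fun c hc hct e he => ?_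
        rw [← hs]
        exact Finset.mem_union_right _ (mem_arcs.2
          ⟨c, Finset.mem_filter.2 ⟨hc, hct⟩, Finset.mem_product.1 he⟩)
  exact h.comp theory_proj

end PTime

/-! ### The search for a super-elementary set -/

open scoped Classical in
theorem SelectionRule.pick_mem_lastLevel (sel : SelectionRule) {X : Finset ℕ}
    {E : Finset (ℕ × ℕ)} (hX : X.Nonempty) : sel.pick (lastLevel X E) ∈ X :=
  (Finset.mem_filter.1 (sel.pick_mem _ (lastLevel_nonempty E hX))).1

theorem nonempty_of_not_stronglyConnected {X : Finset ℕ} {E : Finset (ℕ × ℕ)}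
    (h : ¬ StronglyConnected X E) : X.Nonempty := by
  by_contra hne
  rw [Finset.not_nonempty_iff_eq_empty] at hne
  exact h (by simp [StronglyConnected, hne])

open scoped Classical in
-- If the component of `u` exhausted `X`, any two nodes would be connected through `u`.
theorem sdiff_component_nonempty {X : Finset ℕ} {E : Finset (ℕ × ℕ)}
    (h : ¬ StronglyConnected X E) (u : ℕ) : (X \ component X E u).Nonempty := by
  rw [Finset.sdiff_nonempty]
  intro hsub
  refine h fun v hv w hw => ?_
  exact (Finset.mem_filter.1 (hsub hv)).2.2.trans (Finset.mem_filter.1 (hsub hw)).2.1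

theorem findLoop_subset (test : BodyTest) (sel : SelectionRule) (T : Theory) (X : Finset ℕ) :
    findLoop test sel T X ⊆ X := by
  induction X using findLoop.induct (test := test) (sel := sel) (T := T) with
  | case1 =>
    rename_i X E h
    rw [findLoop, if_pos h]
  | case2 =>
    rename_i X E h ih
    rw [findLoop, if_neg h]
    exact ih.trans Finset.sdiff_subset

theorem findLoop_nonempty {test : BodyTest} {sel : SelectionRule} {T : Theory} {X : Finset ℕ}
    (hX : X.Nonempty) : (findLoop test sel T X).Nonempty := by
  induction X using findLoop.induct (test := test) (sel := sel) (T := T) with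
  | case1 X E h => rwa [findLoop, if_pos h]
  | case2 X E h ih =>
    rw [findLoop, if_neg h]
    exact ih (sdiff_component_nonempty h _)

namespace PTime

open scoped Classical in
/-- A polynomial-time selection rule extends to a total polynomial-time function. -/
theorem pick {sel : SelectionRule} (hsel : sel.PolyTime) :
    PTime fun s : Finset ℕ => if s.Nonempty then sel.pick s else 0 := by
  obtain ⟨p, q, h⟩ := hsel
  obtain ⟨p₀, q₀, h₀⟩ := pTime_iff.1 (id (α := Finset ℕ)).finset_nonempty
  refine pTime_iff.2 ⟨.ite p₀ p .nil, 2 * .X + q₀ + q, fun s d hd => ?_⟩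
  obtain ⟨e₀, t₀, hr₀, he₀, ht₀⟩ := h₀ s d hd
  simp only [Polynomial.eval_add, Polynomial.eval_X, Polynomial.eval_mul, Polynomial.eval_ofNat]
  split_ifs with hs
  · obtain ⟨e, t, hr, he, ht⟩ := h s hs d hd
    exact ⟨e, _, .ite_true hr₀ (he₀.2 hs) hr, he, by omega⟩
  · have : e₀ = .nil := by_contra fun hne => hs (he₀.1 hne)
    subst this
    -- The default value 0 has no binary digits, so `nil` represents it.
    exact ⟨.nil, _, .ite_false hr₀ (.nil _), by simp [rep, repAtom, Data.ofNat, Data.ofList],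
      by omega⟩

theorem findSuperElementarySet (test : BodyTest) {sel : SelectionRule} (hsel : sel.PolyTime) :
    PTime (findSuperElementarySet test sel) := by
  classical
  let E : Theory → Finset ℕ → Finset (ℕ × ℕ) := fun T X => MinModel.elemArcs test T.nd X
  -- One step of the search. The guard on the last level only makes the selection total; it always
  -- holds when the graph is not strongly connected.
  let g : Theory → Finset ℕ → Finset ℕ := fun T X =>
    if StronglyConnected X (E T X) then X
    else X \ MinModel.component X (E T X) (if (MinModel.lastLevel X (E T X)).Nonempty
      then sel.pick (MinModel.lastLevel X (E T X)) else 0)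
  have hE : PTime fun x : Theory × Finset ℕ => E x.1 x.2 :=
    (elemArcs test).comp ((theory_nd.comp fst).pair snd)
  have hg : PTime fun x : Theory × Finset ℕ => g x.1 x.2 :=
    ite (stronglyConnected snd hE) snd
      (snd.sdiff (component snd hE ((pick hsel).comp (lastLevel snd hE))))
  have hsub : ∀ T X, g T X ⊆ X := by
    intro T X
    simp only [g]
    split_ifs <;> simp [Finset.sdiff_subset]
  refine iterate hg theory_atoms theory_atoms (fun _ => subset_rfl)
    (fun T X hX => (hsub T X).trans hX) fun T n hn => ?_
  refine iterate_eq_of_deflationary (F := findLoop test sel T) (hsub T) (fun X => ?_)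
    (fun X hX => ?_) n T.atoms hn
  · by_cases h : StronglyConnected X (E T X)
    · simp only [g, if_pos h]
    · have := lastLevel_nonempty (E T X) (nonempty_of_not_stronglyConnected h)
      simp only [g, if_neg h, if_pos this]
      conv_rhs => rw [findLoop, if_neg h]
  -- Otherwise `g` would remove at least the selected atom, which belongs to its own component.
  · have h : StronglyConnected X (E T X) := by
      by_contra h
      have hX' := nonempty_of_not_stronglyConnected h
      simp only [g, if_neg h, if_pos (lastLevel_nonempty (E T X) hX'),
        Finset.sdiff_eq_self_iff_disjoint] at hX
      have hp := sel.pick_mem_lastLevel (E := E T X) hX'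
      exact Finset.disjoint_left.1 hX hp (mem_component_self _ hp)
    rw [findLoop, if_pos h]

end PTime

/-! ### The main loop -/

namespace Theory

theorem steadySet_subset (T : Theory) (M : Finset ℕ) : T.steadySet M ⊆ M := by
  classical exact Finset.filter_subset _ _

/-- The steady set does not shrink when atoms outside it are removed from `M`. -/
theorem steadySet_subset_steadySet {T : Theory} {M N : Finset ℕ} (hNM : N ⊆ M)
    (hN : T.steadySet M ⊆ N) : T.steadySet M ⊆ T.steadySet N := by
  classical
  -- By minimality of the steady set of `M`, it suffices that its intersection with the steady set
  -- of `N` still satisfies the Horn theory of `M`.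
  have h : (T.projHead M).nd.Sat (T.steadySet M ∩ T.steadySet N) := by
    intro c hc
    by_cases hb : ∃ b ∈ c.body, b ∉ T.steadySet M ∩ T.steadySet N
    · exact .inr hb
    push Not at hb
    obtain ⟨hc', hcard⟩ := Finset.mem_filter.1 hc
    obtain ⟨hi, -⟩ := Finset.mem_filter.1 hc'
    obtain ⟨c₀, hc₀, rfl⟩ := Finset.mem_image.1 hi
    rcases steadySet_sat T M _ hc with ⟨a, ha, haS⟩ | ⟨b, hb', hbS⟩
    -- The only head atom of the clause in `M` is steady, hence in `N`. The clause thus survives the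
    -- projection on `N`, remains Horn there, and forces the same atom.
    · have haN : a ∈ c₀.head ∩ N := Finset.mem_inter.2 ⟨(Finset.mem_inter.1 ha).1, hN haS⟩
      have hle : (c₀.head ∩ N).card ≤ (c₀.head ∩ M).card :=
        Finset.card_le_card (Finset.inter_subset_inter_left hNM)
      have hcN : c₀.projHead N ∈ (T.projHead N).nd :=
        Finset.mem_filter.2 ⟨Finset.mem_filter.2 ⟨Finset.mem_image_of_mem _ hc₀, ⟨a, haN⟩⟩,
          fun h => hcard (lt_of_lt_of_le h hle)⟩
      rcases steadySet_sat T N _ hcN with ⟨a', ha', haS'⟩ | ⟨b, hb', hbS⟩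
      · have : a = a' := Finset.card_le_one.1 (not_lt.1 hcard) a ha a'
          (Finset.inter_subset_inter_left hNM ha')
        exact .inl ⟨a, ha, Finset.mem_inter.2 ⟨haS, this ▸ haS'⟩⟩
      · exact absurd (Finset.mem_inter.1 (hb b hb')).2 hbS
    · exact absurd (Finset.mem_inter.1 (hb b hb')).1 hbS
  exact (steadySet_subset_of_sat h).trans Finset.inter_subset_right

theorem atoms_proj_subset (T : Theory) (X : Finset ℕ) : (T.proj X).atoms ⊆ X := by
  intro a ha
  obtain ⟨c, hc, hac⟩ := Finset.mem_biUnion.1 ha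
  obtain ⟨c₀, -, rfl⟩ := Finset.mem_image.1 (Finset.mem_filter.1 hc).1
  rcases Finset.mem_union.1 hac with h | h <;> exact (Finset.mem_inter.1 h).2

open scoped Classical in
/-- A model that equals its steady set is minimal. -/
theorem IsModel.isMinimalModel_of_subset_steadySet {T : Theory} {M : Finset ℕ} (hM : T.IsModel M)
    (h : M ⊆ T.steadySet M) : T.IsMinimalModel M := by
  -- For a model `J ⊂ M`, a head atom in `J` lies in `M` and survives the projection of the head. So
  -- `J` satisfies the Horn theory and contains the steady set, that is, all of `M`.
  refine ⟨hM, fun J hJ hJm => hJ.2 (h.trans (steadySet_subset_of_sat fun c hc => ?_))⟩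
  obtain ⟨c₀, hc₀, rfl⟩ := Finset.mem_image.1
    (Finset.mem_filter.1 (Finset.mem_filter.1 hc).1).1
  rcases hJm.2 c₀ hc₀ with ⟨a, ha, haJ⟩ | hb
  · exact .inl ⟨a, Finset.mem_inter.2 ⟨ha, hJ.1 haJ⟩, haJ⟩
  · exact .inr hb

end Theory

theorem deltaE_subset_sdiff (sel : SelectionRule) (T : Theory) (M : Finset ℕ) :
    deltaE sel T M ⊆ M \ T.steadySet M := by
  unfold deltaE
  simp only
  split_ifs with h₁ h₂
  · exact Finset.sdiff_subset
  · exact Finset.singleton_subset_iff.2 (Finset.sdiff_subset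
      (sel.pick_mem _ (Finset.sdiff_nonempty.2 h₂.2)))
  · exact Finset.empty_subset _

theorem sdiff_deltaE_eq_self_iff {sel : SelectionRule} {T : Theory} {M : Finset ℕ} :
    M \ deltaE sel T M = M ↔ deltaE sel T M = ∅ := by
  rw [Finset.sdiff_eq_self_iff_disjoint]
  constructor
  · exact fun h => Finset.disjoint_self_iff_empty _ |>.1 (h.mono_left (deltaE_subset sel T M))
  · intro h; simp [h]

theorem union_sdiff_eq_of_subset {E D N R : Finset ℕ} (hD : D ⊆ N) (hR : R ⊆ N \ D) :
    E ∪ D ∪ (N \ D) \ R = E ∪ N \ R := by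
  ext a
  have h₁ := @hD a
  have h₂ := @hR a
  simp only [Finset.mem_union, Finset.mem_sdiff] at h₁ h₂ ⊢
  tauto

/-- The main loop repeatedly removes the atoms `deltaE` from `M`. -/
theorem xiLoop_eq_iterate (sel : SelectionRule) (T : Theory) : ∀ (n : ℕ) (M E : Finset ℕ),
    (M \ E).card ≤ n → xiLoop sel T M E =
      ((fun N => N \ deltaE sel T N)^[n] (M \ E),
        E ∪ (M \ E) \ (fun N => N \ deltaE sel T N)^[n] (M \ E)) := by
  intro n
  induction n with
  | zero =>
    intro M E h
    have h₀ : M \ E = ∅ := Finset.card_eq_zero.1 (Nat.le_zero.1 h)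
    have h₁ : deltaE sel T (M \ E) = ∅ := by
      rw [h₀]; exact Finset.subset_empty.1 (deltaE_subset sel T ∅)
    rw [xiLoop, if_pos h₁, h₁, h₀]
    simp
  | succ n ih =>
    intro M E h
    rw [xiLoop]
    split_ifs with hD
    · rw [Function.iterate_fixed (sdiff_deltaE_eq_self_iff.2 hD), hD]
      simp
    -- The loop subtracts the whole accumulated set each time, but its earlier part is already gone.
    · have hs : (M \ E) \ (E ∪ deltaE sel T (M \ E)) = (M \ E) \ deltaE sel T (M \ E) := by
        rw [Finset.sdiff_union_distrib, Finset.sdiff_idem]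
        exact Finset.inter_eq_right.2 Finset.sdiff_subset
      have hlt : ((M \ E) \ deltaE sel T (M \ E)).card < (M \ E).card :=
        Finset.card_lt_card (Finset.sdiff_subset.ssubset_of_ne
          fun h => hD (sdiff_deltaE_eq_self_iff.1 h))
      rw [ih _ _ (by rw [hs]; omega), hs, Function.iterate_succ_apply]
      have hit : ∀ (k : ℕ) (N : Finset ℕ), (fun N => N \ deltaE sel T N)^[k] N ⊆ N := by
        intro k
        induction k with
        | zero => exact fun N => subset_rfl
        | succ k ih => exact fun N => (ih _).trans Finset.sdiff_subset
      exact Prod.ext rfl (union_sdiff_eq_of_subset (deltaE_subset _ _ _) (hit n _))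

/-- These are invariants of iterated removal: each round takes away only atoms that are not steady,
so the steady set can only grow, and the accumulated set is exactly what has been removed. -/
theorem xiLoop_empty (sel : SelectionRule) (T : Theory) (M : Finset ℕ) :
    (xiLoop sel T M ∅).1 ⊆ M ∧ (xiLoop sel T M ∅).2 = M \ (xiLoop sel T M ∅).1 ∧
      T.steadySet M ⊆ T.steadySet (xiLoop sel T M ∅).1 := by
  have hit : ∀ n, (fun N => N \ deltaE sel T N)^[n] M ⊆ M ∧
      T.steadySet M ⊆ T.steadySet ((fun N => N \ deltaE sel T N)^[n] M) := by
    intro n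
    induction n with
    | zero => exact ⟨subset_rfl, subset_rfl⟩
    | succ n ih =>
      rw [Function.iterate_succ_apply']
      set N := (fun N => N \ deltaE sel T N)^[n] M
      refine ⟨Finset.sdiff_subset.trans ih.1, ih.2.trans
        (Theory.steadySet_subset_steadySet Finset.sdiff_subset fun a ha => ?_)⟩
      exact Finset.mem_sdiff.2 ⟨T.steadySet_subset N ha, fun hD =>
        (Finset.mem_sdiff.1 (deltaE_subset_sdiff sel T N hD)).2 ha⟩
  rw [xiLoop_eq_iterate sel T _ M ∅ le_rfl]
  simp only [Finset.sdiff_empty, Finset.empty_union]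
  exact ⟨(hit _).1, trivial, (hit _).2⟩

theorem xiHEF_subset (test : BodyTest) (sel : SelectionRule) (T : Theory) (M : Finset ℕ) :
    xiHEF test sel T M ⊆ M \ T.steadySet M := by
  obtain ⟨h₁, h₂, h₃⟩ := xiLoop_empty sel T M
  have hS := h₃.trans (Theory.steadySet_subset T _)
  unfold xiHEF
  simp only [h₂]
  refine Finset.union_subset (Finset.sdiff_subset_sdiff subset_rfl hS) ?_
  -- In both cases `E''` consists of non-steady atoms of the final set; as the steady set has only
  -- grown, these are non-steady atoms of `M`.
  refine subset_trans ?_ (Finset.sdiff_subset_sdiff h₁ h₃)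
  split_ifs
  · exact subset_rfl
  · exact (findLoop_subset _ _ _ _).trans (Theory.atoms_proj_subset _ _)

/-- If the operator returns the empty set, then all atoms of `M` are steady. -/
theorem subset_steadySet_of_xiHEF_eq_empty {test : BodyTest} {sel : SelectionRule} {T : Theory}
    {M : Finset ℕ} (h : xiHEF test sel T M = ∅) : M ⊆ T.steadySet M := by
  obtain ⟨h₁, h₂, -⟩ := xiLoop_empty sel T M
  unfold xiHEF at h
  simp only [h₂, Finset.union_eq_empty] at h
  obtain ⟨hE', hE''⟩ := h
  rw [h₁.antisymm (Finset.sdiff_eq_empty_iff_subset.1 hE')] at hE''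
  split_ifs at hE'' with hnd
  · exact Finset.sdiff_eq_empty_iff_subset.1 hE''
  -- A disjunctive clause has a head atom, so the search starts on a non-empty set and cannot return
  -- the empty one.
  · unfold Theory.NonDisjunctive at hnd
    push Not at hnd
    obtain ⟨c, hc, hdisj⟩ := hnd
    obtain ⟨a, ha⟩ := Finset.card_pos.1 (Nat.zero_lt_of_lt hdisj)
    have hne : (T.ssimpl M).atoms.Nonempty :=
      ⟨a, Finset.mem_biUnion.2 ⟨c, hc, Finset.mem_union_left _ ha⟩⟩
    exact absurd hE'' (findLoop_nonempty hne).ne_empty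

namespace PTime

theorem deltaE {sel : SelectionRule} (hsel : sel.PolyTime) :
    PTime fun x : Theory × Finset ℕ => deltaE sel x.1 x.2 := by
  classical
  have hS : PTime fun x : Theory × Finset ℕ => x.2 \ x.1.steadySet x.2 := snd.sdiff steadySet
  have hA := theory_atoms.comp theory_ssimpl
  have hN := theory_atoms.comp (theory_nd.comp theory_ssimpl)
  have h := ite (hA.ssubset hS) (hS.sdiff hA) (ite (hN.ssubset hS)
    ((pick hsel).comp (hS.sdiff hN)).singleton (const ∅))
  refine (congrArg PTime (funext fun x => ?_)).mp h
  unfold MinModel.deltaE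
  simp only
  by_cases h₂ : (x.1.ssimpl x.2).nd.atoms ⊂ x.2 \ x.1.steadySet x.2
  · rw [if_pos (Finset.sdiff_nonempty.2 h₂.2)]
  · simp only [if_neg h₂]

theorem xiHEF (test : BodyTest) {sel : SelectionRule} (hsel : sel.PolyTime) :
    PTime fun x : Theory × Finset ℕ => xiHEF test sel x.1 x.2 := by
  classical
  have hloop : PTime fun x : Theory × Finset ℕ => (xiLoop sel x.1 x.2 ∅).1 := by
    let g : Theory × Finset ℕ → Finset ℕ → Finset ℕ := fun x N => N \ MinModel.deltaE sel x.1 N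
    have hD : PTime fun x : (Theory × Finset ℕ) × Finset ℕ => MinModel.deltaE sel x.1.1 x.2 := by
      have h := (deltaE hsel).comp ((fst.comp fst).pair
        (snd (α := Theory × Finset ℕ) (β := Finset ℕ)))
      exact h
    have hg : PTime fun x : (Theory × Finset ℕ) × Finset ℕ => g x.1 x.2 := snd.sdiff hD
    refine iterate hg snd snd (fun _ => subset_rfl)
      (fun x N hN => Finset.sdiff_subset.trans hN) fun x n hn => ?_
    rw [xiLoop_eq_iterate sel x.1 n x.2 ∅ (by simpa using hn), Finset.sdiff_empty]
  have hpair := fst.pair hloop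
  have hs := theory_ssimpl.comp hpair
  have h := (snd.sdiff hloop).union (ite (theory_nonDisjunctive.comp hs)
    (hloop.sdiff (steadySet.comp hpair)) ((findSuperElementarySet test hsel).comp hs))
  refine (congrArg PTime (funext fun x => ?_)).mp h
  unfold MinModel.xiHEF
  simp only [(xiLoop_empty sel x.1 x.2).2.1]

end PTime

/-! ### A polynomial-time selection rule -/

/-- Removal of the longest common prefix of two lists. -/
def dropCommonPrefix {ι : Type} [DecidableEq ι] : List ι → List ι → List ι × List ι
  | a :: l, b :: m => if a = b then dropCommonPrefix l m else (a :: l, b :: m)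
  | [], m => ([], m)
  | l, [] => (l, [])

theorem PTime.data_dropCommonPrefix : PTime fun x : Data × Data =>
    let r := dropCommonPrefix x.1.toList x.2.toList
    Data.cons (.ofList r.1) (.ofList r.2) := by
  let b : Data → Prop := fun d => d.left ≠ .nil ∧ d.right ≠ .nil ∧ d.left.left = d.right.left
  let g : Data → Data := fun d => .cons d.left.right d.right.right
  have hb : PTime b := (data_ne_nil.comp data_left).and ((data_ne_nil.comp data_right).and
    (data_eq.comp ((data_left.comp data_left).pair (data_left.comp data_right))))
  have hg : PTime g := (data_right.comp data_left).data_cons (data_right.comp data_right)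
  -- The loop lemma wants a function on all trees; `nil`, which is not a pair of lists, is left
  -- unchanged.
  let f : Data → Data := fun d => match d with
    | .nil => .nil
    | .cons l m =>
      let r := dropCommonPrefix l.toList m.toList
      .cons (.ofList r.1) (.ofList r.2)
  have key : ∀ l m : List Data, ∃ n ≤ l.length, f (.cons (.ofList l) (.ofList m)) =
      g^[n] (.cons (.ofList l) (.ofList m)) ∧ ¬ b (g^[n] (.cons (.ofList l) (.ofList m))) ∧
      (∀ k < n, b (g^[k] (.cons (.ofList l) (.ofList m)))) ∧
      ∀ k ≤ n, (g^[k] (.cons (.ofList l) (.ofList m))).size ≤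
        (Data.cons (.ofList l) (.ofList m)).size := by
    intro l
    induction l with
    | nil =>
      intro m
      exact ⟨0, by simp, by simp [f, dropCommonPrefix], by simp [b, Data.left, Data.ofList],
        by simp, by simp⟩
    | cons x l ih =>
      rintro (_ | ⟨y, m⟩)
      · exact ⟨0, by simp, by simp [f, dropCommonPrefix],
          by simp [b, Data.right, Data.ofList], by simp, by simp⟩
      · by_cases hxy : x = y
        · subst hxy
          obtain ⟨n, hn, h₁, h₂, h₃, h₄⟩ := ih m
          refine ⟨n + 1, by simpa using hn, ?_, h₂, ?_, ?_⟩
          · rw [Function.iterate_succ_apply]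
            refine Eq.trans ?_ h₁
            simp [f, dropCommonPrefix]
          · rintro (_ | k) hk
            · simp [b, Data.left, Data.right, Data.ofList]
            · exact h₃ k (by omega)
          · rintro (_ | k) hk
            · exact le_rfl
            · refine (h₄ k (by omega)).trans ?_
              simp only [Data.ofList, Data.size]; omega
        · exact ⟨0, by simp, by simp [f, dropCommonPrefix, hxy],
            by simp [b, Data.left, Data.right, Data.ofList, hxy], by simp, by simp⟩
  have hf : PTime f := data_while hb hg .X .X fun d => by
    cases d with
    | nil => exact ⟨0, by simp, rfl, by simp [b, Data.left], by simp, by simp⟩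
    | cons l m =>
      obtain ⟨n, hn, h⟩ := key l.toList m.toList
      have := Data.length_lt_size_ofList l.toList
      simp only [Data.ofList_toList, Polynomial.eval_X] at h this ⊢
      exact ⟨n, by simp only [Data.size]; omega, h⟩
  exact hf.comp (fst.data_cons snd)

/-- After the common prefix is removed, `l` precedes or equals `m` when `l` is exhausted, or when
neither is exhausted and the next digit of `l` is 0, that of `m` then being 1. The digit 0 is
encoded by `nil`. -/
theorem not_lex_iff_dropCommonPrefix (l m : List Bool) :
    ¬ List.Lex (· < ·) m l ↔
      (Data.ofList (dropCommonPrefix (l.map Data.ofBool) (m.map Data.ofBool)).1 = .nil ∨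
        Data.ofList (dropCommonPrefix (l.map Data.ofBool) (m.map Data.ofBool)).2 ≠ .nil ∧
        (Data.ofList (dropCommonPrefix (l.map Data.ofBool) (m.map Data.ofBool)).1).left = .nil) := by
  induction l generalizing m with
  | nil => simp [dropCommonPrefix, Data.ofList]
  | cons a l ih =>
    cases m with
    | nil => simp [dropCommonPrefix, Data.ofList]
    | cons b m =>
      rw [List.cons_lex_cons_iff]
      cases a <;> cases b
      · simpa [dropCommonPrefix, Data.ofBool, Data.ofList, Data.left] using ih m
      · simp [dropCommonPrefix, Data.ofBool, Data.ofList, Data.left]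
      · simp [dropCommonPrefix, Data.ofBool, Data.ofList, Data.left]
      · simpa [dropCommonPrefix, Data.ofBool, Data.ofList, Data.left] using ih m

/-- The order of the atoms by their sequences of binary digits. -/
def BitsLE (a b : ℕ) : Prop := a.bits ≤ b.bits

theorem pTime_bitsLE : PTime fun x : ℕ × ℕ => BitsLE x.1 x.2 := by
  have hN : PTime Data.ofNat := .of_rep fun a d h => Eq.symm h
  have h := PTime.data_dropCommonPrefix.comp
    ((hN.comp (PTime.fst (α := ℕ) (β := ℕ))).pair (hN.comp PTime.snd))
  have h₁ := PTime.data_left.comp h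
  have h₂ := PTime.data_right.comp h
  refine (congrArg PTime (funext fun x => propext ?_)).mp ((PTime.data_ne_nil.comp h₁).not.or
    ((PTime.data_ne_nil.comp h₂).and (PTime.data_ne_nil.comp (PTime.data_left.comp h₁)).not))
  rw [BitsLE, ← not_lt]
  refine Iff.trans ?_ (not_lex_iff_dropCommonPrefix _ _).symm
  simp [Data.ofNat, Data.left, Data.right]

/-- A number is determined by its digits, so the lexicographic order is antisymmetric on atoms. It
need not agree with the numerical order; any easily decidable linear order will do. -/
theorem exists_unique_bitsLE_min {s : Finset ℕ} (hs : s.Nonempty) :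
    ∃! a, a ∈ s ∧ ∀ b ∈ s, BitsLE a b := by
  obtain ⟨a, ha, hmin⟩ := s.exists_min_image Nat.bits hs
  refine ⟨a, ⟨ha, hmin⟩, fun b ⟨hb, hb'⟩ => ?_⟩
  have := le_antisymm (hb' a ha) (hmin b hb)
  exact Nat.digits.injective 2 (by rw [Nat.digits_two_eq_bits, this, Nat.digits_two_eq_bits])

open scoped Classical in
theorem exists_polyTime_selectionRule : ∃ sel : SelectionRule, sel.PolyTime := by
  choose! f hf hf' using fun (s : Finset ℕ) (hs : s.Nonempty) => exists_unique_bitsLE_min hs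
  refine ⟨⟨f, fun s hs => (hf s hs).1⟩, ?_⟩
  have h : PTime fun s : Finset ℕ => if s.Nonempty then f s else 0 := by
    -- The set of least elements is a singleton, so the first entry of any list for it is the
    -- selected atom, however often it is repeated; `{0}` covers the empty set.
    refine .of_singleton ((congrArg PTime (funext fun s => ?_)).mp
      (PTime.ite (PTime.finset_nonempty PTime.id) (PTime.filter (P := fun s a => ∀ b ∈ s, BitsLE a b)
        PTime.id (PTime.forall_mem PTime.fst (pTime_bitsLE.comp
          ((PTime.snd.comp PTime.fst).pair PTime.snd)))) (PTime.const {0})))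
    split_ifs with hs
    · ext a
      rw [Finset.mem_filter, Finset.mem_singleton]
      exact ⟨hf' s hs a, by rintro rfl; exact hf s hs⟩
    · rfl
  obtain ⟨p, q, h⟩ := pTime_iff.1 h
  refine ⟨p, q, fun s hs d hd => ?_⟩
  have := h s d hd
  rwa [if_pos (show s.Nonempty from hs)] at this

end MinModel

theorem mainTheorem10 (test : MinModel.BodyTest) :
    (∃ sel : MinModel.SelectionRule, sel.PolyTime) ∧
    (∀ sel : MinModel.SelectionRule, sel.PolyTime →
      MinModel.IsFallibleEliminatingOperator (MinModel.xiHEF test sel)) ∧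
    (∀ (sel : MinModel.SelectionRule) (T : MinModel.Theory) (M : Finset ℕ),
      T.Positive → T.IsModel M →
        MinModel.xiHEF test sel T M ⊆ M \ T.steadySet M ∧
        (¬ T.IsModel (T.steadySet M) → (MinModel.xiHEF test sel T M).Nonempty) ∧
        (MinModel.xiHEF test sel T M = ∅ → T.IsMinimalModel M)) := by
  have hmin : ∀ (sel : MinModel.SelectionRule) (T : MinModel.Theory) (M : Finset ℕ),
      T.IsModel M → MinModel.xiHEF test sel T M = ∅ → T.IsMinimalModel M :=
    fun sel T M hM h => hM.isMinimalModel_of_subset_steadySet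
      (MinModel.subset_steadySet_of_xiHEF_eq_empty h)
  refine ⟨MinModel.exists_polyTime_selectionRule, fun sel hsel => ⟨?_, fun T M _ hM =>
    ⟨MinModel.xiHEF_subset test sel T M, hmin sel T M hM⟩⟩, fun sel T M _ hM =>
    ⟨MinModel.xiHEF_subset test sel T M, fun hS => ?_, hmin sel T M hM⟩⟩
  · obtain ⟨p, q, h⟩ := MinModel.PTime.xiHEF test hsel
    exact ⟨p, q, fun x _ => h x trivial⟩
  -- An empty result would make `M` equal to its steady set, which would then be a model.
  · by_contra hne
    have h := MinModel.subset_steadySet_of_xiHEF_eq_empty (Finset.not_nonempty_iff_eq_empty.1 hne)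
    rw [(T.steadySet_subset M).antisymm h] at hS
    exact hS hM
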